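/- For $0<q\le 1$ and $m\in\mathbb N=\{1,2,3,\dots\}$ let $B_m(q)$ be the Bernoulli polynomial, $H_r=1+\frac12+\dots+\frac1r$ (with $H_0=0$), $A_m(q)=m\,\zeta'(1-m,q)$, where $\zeta(s,q)$ is the Hurwitz zeta function and the prime denotes the derivative in $s$, and let $$\psi^{(-m)}(q)=\frac{1}{m!}\bigl[A_m(q)-H_{m-1}B_m(q)\bigr]$$ be the balanced negapolygamma function. For $m,n\in\mathbb N$ put $$K_{m,n}=\int_0^1\psi^{(-m)}(q)B_n(q)\ln\Gamma(q)\,dq,\qquad K^*_{m,n}=\int_0^1\psi^{(-m)}(1-q)B_n(q)\ln\Gamma(q)\,dq,$$ $$Z_{m,n}=\int_0^1\psi^{(-m)}(q)\psi^{(-n)}(q)\ln\Gamma(q)\,dq,\qquad Z^*_{m,n}=\int_0^1\psi^{(-m)}(q)\psi^{(-n)}(1-q)\ln\Gamma(q)\,dq .$$ Theorem. Let $n_1,n_2,n_3$ be positive integers and $\alpha=n_1+n_2+n_3$. The double series $$T(n_1,n_2,n_3)=\sum_{n=1}^\infty\sum_{m=1}^\infty\frac{1}{n^{n_1}m^{n_2}(n+m)^{n_3}}$$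 converges, all the integrals $K_{m,n},K^*_{m,n},Z_{m,n},Z^*_{m,n}$ $(m,n\in\mathbb N)$ converge absolutely, and $T(n_1,n_2,n_3)$ is a finite expression in the Riemann zeta function, its derivatives and these integrals, in the following sense. Let $\mathcal A_\alpha\subset\mathbb R$ be the $\mathbb Q$-algebra generated by $\pi^{-2}$ and the values $\zeta^{(j)}(k)$ with $0\le j\le 2$ and $k$ an integer, $-1\le k\le\alpha$, $k\ne 1$. Then there are elements $e,\ a_{m,n},\ b_{m,n},\ c_{m,n},\ d_{m,n}$ of $\mathcal A_\alpha$ such that $$T(n_1,n_2,n_3)=e+\sum_{\substack{m,n\ge 1\\ m+n=\alpha-1}}\bigl(a_{m,n}K_{m,n}+b_{m,n}K^*_{m,n}+c_{m,n}Z_{m,n}+d_{m,n}Z^*_{m,n}\bigr).$$ -/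

import Mathlib

noncomputable section

/-- The Tornheim double series
`T(a,b,c) = ∑_{n ≥ 1} ∑_{m ≥ 1} 1 / (n^a m^b (n+m)^c)`. -/
def tornheim (a b c : ℕ) : ℝ :=
  ∑' n : ℕ+, ∑' m : ℕ+, 1 / ((n : ℝ) ^ a * (m : ℝ) ^ b * ((n : ℝ) + (m : ℝ)) ^ c)

/-- The Bernoulli function `A_m(q) = m ζ'(1 - m, q)` for `m ≥ 1` and `0 < q ≤ 1`, where `ζ(s, q)` is
the Hurwitz zeta function and the derivative is taken in `s`.
The derivative is a real number; the real part only changes its type. -/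
def bernoulliA (m : ℕ) (q : ℝ) : ℝ :=
  (m : ℝ) * (deriv (HurwitzZeta.hurwitzZeta (q : UnitAddCircle)) (1 - (m : ℂ))).re

/-- The balanced negapolygamma function
`ψ^{(-m)}(q) = (A_m(q) - H_{m-1} B_m(q)) / m!` for `m ≥ 1` and `0 < q ≤ 1`. -/
def negapolygamma (m : ℕ) (q : ℝ) : ℝ :=
  (bernoulliA m q - (harmonic (m - 1) : ℝ) * bernoulliFun m q) / (m.factorial : ℝ)

/-- `ln Γ(q)`, used for `q > 0` only. -/
def logGamma (q : ℝ) : ℝ := Real.log (Real.Gamma q)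

/-- The integrand of `K_{m,n}`. -/
def integrandK (m n : ℕ) (q : ℝ) : ℝ :=
  negapolygamma m q * bernoulliFun n q * logGamma q

/-- The integrand of `K*_{m,n}`. -/
def integrandKStar (m n : ℕ) (q : ℝ) : ℝ :=
  negapolygamma m (1 - q) * bernoulliFun n q * logGamma q

/-- The integrand of `Z_{m,n}`. -/
def integrandZ (m n : ℕ) (q : ℝ) : ℝ :=
  negapolygamma m q * negapolygamma n q * logGamma q

/-- The integrand of `Z*_{m,n}`. -/
def integrandZStar (m n : ℕ) (q : ℝ) : ℝ :=
  negapolygamma m q * negapolygamma n (1 - q) * logGamma q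

/-- `K_{m,n} = ∫₀¹ ψ^{(-m)}(q) B_n(q) ln Γ(q) dq`. -/
def integralK (m n : ℕ) : ℝ := ∫ q in (0 : ℝ)..1, integrandK m n q

/-- `K*_{m,n} = ∫₀¹ ψ^{(-m)}(1-q) B_n(q) ln Γ(q) dq`. -/
def integralKStar (m n : ℕ) : ℝ := ∫ q in (0 : ℝ)..1, integrandKStar m n q

/-- `Z_{m,n} = ∫₀¹ ψ^{(-m)}(q) ψ^{(-n)}(q) ln Γ(q) dq`. -/
def integralZ (m n : ℕ) : ℝ := ∫ q in (0 : ℝ)..1, integrandZ m n q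

/-- `Z*_{m,n} = ∫₀¹ ψ^{(-m)}(q) ψ^{(-n)}(1-q) ln Γ(q) dq`. -/
def integralZStar (m n : ℕ) : ℝ := ∫ q in (0 : ℝ)..1, integrandZStar m n q

/-- The real number `ζ^{(j)}(k)`, the `j`-th derivative of the Riemann zeta function at the integer
`k ≠ 1`. -/
def zetaDeriv (j : ℕ) (k : ℤ) : ℝ := (iteratedDeriv j riemannZeta (k : ℂ)).re

/-- The `ℚ`-algebra of real numbers generated by `π⁻²` and the values `ζ(k)`, `ζ'(k)`, `ζ''(k)` at
the integers `-1 ≤ k ≤ w`, `k ≠ 1`. It contains `π² = 6 ζ(2)` and `ln (2π) = -2 ζ'(0)`. -/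
def zetaAlgebra (w : ℕ) : Subalgebra ℚ ℝ :=
  Algebra.adjoin ℚ
    ({(Real.pi ^ 2)⁻¹} ∪
      {x : ℝ | ∃ (j : ℕ) (k : ℤ), j ≤ 2 ∧ -1 ≤ k ∧ k ≤ (w : ℤ) ∧ k ≠ 1 ∧ x = zetaDeriv j k})

/-- The pairs `(m, n)` of positive integers with `m + n = s`. -/
def positivePairs (s : ℕ) : Finset (ℕ × ℕ) :=
  (Finset.HasAntidiagonal.antidiagonal s).filter (fun p => 0 < p.1 ∧ 0 < p.2)

end

/-!
Write `z = exp(2πiq)`. By orthogonality of the exponentials and Abel summation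
(`integral_circlePolylog_mul_mul_conj`), `T(a, b, c)` is the integral over `0 < q < 1` of
`Li_a(z) Li_b(z) conj(Li_c(z))`, while the integral of `Li_a(z) Li_b(z) Li_c(z)` vanishes. Adding or
subtracting the two gives
`T(a, b, c) = 2 ∫ Re(Li_a Li_b) Re Li_c = 2 ∫ Im(Li_a Li_b) Im Li_c`.
Of the real and imaginary parts of `Li_m(z)`, one is a rational multiple of `π^m B_m(q)` and the
other is the Clausen function of order `m`. The derivative of the functional equation of the Hurwitz
zeta function at a positive integer shows that the latter is a rational multiple of
`π^(m-1) (ψ^{(-m)}(q) - (-1)^m ψ^{(-m)}(1 - q))` (`exists_clausenPart_eq`); for `m = 1`, where the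
Dirichlet series is not absolutely convergent, this is Lerch's formula `deriv_hurwitzZeta_zero`
together with Euler's reflection formula.

Partial fractions reduce every `T(n₁, n₂, n₃)` to the `T(1, b, c)` of the same weight and to products
of two zeta values (`isRep_tornheim_of_one`). For `T(1, b, c)` the one of the two formulas is chosen
in which the factor of index `c` is a Bernoulli polynomial. The parity of the weight then decides
what the integrands are.

* In odd weight (`tornheim_eq_of_odd`) each is one Clausen function times two Bernoulli polynomials.
  Expanding their product in Bernoulli polynomials and using Parseval's identity gives zeta values
  times even powers of `π`; no integral is needed.
* In even weight (`tornheim_eq_of_even`) one is a product of three Bernoulli polynomials, whose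
  integral is a rational multiple of an even power of `π`. The other is a product `C_1 f`, with
  `C_1(q) = ln Γ(q) + ln Γ(1 - q) - ln (2π)` and `f` the product of the Clausen function of order `b`
  and a multiple of `B_c`. Here `f(1 - q) = f(q)`, so that
  `∫ C_1 f = 2 ∫ f(q) ln Γ(q) dq - ln (2π) ∫ f`, and the first integral is a combination of `K_{b,c}`
  and `K*_{b,c}` (`isRep_integral_logGamma_mul`).

So `K` and `K*` suffice, and the coefficients of `Z` and `Z*` can be taken to be zero. All integrals
converge since every function that occurs has at most logarithmic growth at `0` and `1` (`IsTame`).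
-/

open Filter Topology MeasureTheory Set

/-! ### Combinations of the integrals with coefficients in the algebra of zeta values -/

/-- `x` is a combination of `1` and of the integrals `K_{m,n}`, `K*_{m,n}` with `m + n = w - 1`,
with coefficients in `zetaAlgebra w`. -/
def IsRep (w : ℕ) (x : ℝ) : Prop :=
  ∃ (e : zetaAlgebra w) (a b : ℕ × ℕ → zetaAlgebra w),
    x = (e : ℝ) + ∑ p ∈ positivePairs (w - 1),
      ((a p : ℝ) * integralK p.1 p.2 + (b p : ℝ) * integralKStar p.1 p.2)

theorem IsRep.of_mem {w : ℕ} {x : ℝ} (hx : x ∈ zetaAlgebra w) : IsRep w x :=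
  ⟨⟨x, hx⟩, 0, 0, by simp⟩

theorem IsRep.add {w : ℕ} {x y : ℝ} (hx : IsRep w x) (hy : IsRep w y) : IsRep w (x + y) := by
  obtain ⟨e, a, b, rfl⟩ := hx
  obtain ⟨e', a', b', rfl⟩ := hy
  refine ⟨e + e', a + a', b + b', ?_⟩
  rw [add_add_add_comm, ← Finset.sum_add_distrib]
  push_cast
  congr 1
  refine Finset.sum_congr rfl fun p _ => ?_
  simp only [Pi.add_apply]
  push_cast
  ring

theorem IsRep.mul {w : ℕ} {x y : ℝ} (hx : x ∈ zetaAlgebra w) (hy : IsRep w y) :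
    IsRep w (x * y) := by
  obtain ⟨e, a, b, rfl⟩ := hy
  refine ⟨⟨x, hx⟩ * e, fun p => ⟨x, hx⟩ * a p, fun p => ⟨x, hx⟩ * b p, ?_⟩
  rw [mul_add, Finset.mul_sum]
  push_cast
  congr 1
  refine Finset.sum_congr rfl fun p _ => ?_
  ring

theorem IsRep.sub {w : ℕ} {x y : ℝ} (hx : IsRep w x) (hy : IsRep w y) : IsRep w (x - y) := by
  rw [sub_eq_add_neg, ← neg_one_mul]
  exact hx.add (.mul (neg_mem (one_mem _)) hy)

theorem isRep_integralK {m n : ℕ} (hm : 0 < m) (hn : 0 < n) :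
    IsRep (m + n + 1) (integralK m n) := by
  classical
  refine ⟨0, Pi.single (m, n) 1, 0, ?_⟩
  have hmem : (m, n) ∈ positivePairs (m + n + 1 - 1) := by simp [positivePairs, hm, hn]
  rw [Finset.sum_eq_single_of_mem _ hmem]
  · simp
  · intro p _ hp
    simp [hp]

theorem isRep_integralKStar {m n : ℕ} (hm : 0 < m) (hn : 0 < n) :
    IsRep (m + n + 1) (integralKStar m n) := by
  classical
  refine ⟨0, 0, Pi.single (m, n) 1, ?_⟩
  have hmem : (m, n) ∈ positivePairs (m + n + 1 - 1) := by simp [positivePairs, hm, hn]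
  rw [Finset.sum_eq_single_of_mem _ hmem]
  · simp
  · intro p _ hp
    simp [hp]

theorem ratCast_mem_zetaAlgebra (w : ℕ) (x : ℚ) : (x : ℝ) ∈ zetaAlgebra w :=
  (zetaAlgebra w).algebraMap_mem x

theorem ofReal_tsum_one_div_nat_pow {k : ℕ} (hk : 2 ≤ k) :
    riemannZeta k = ((∑' n : ℕ, 1 / (n : ℝ) ^ k : ℝ) : ℂ) := by
  rw [zeta_nat_eq_tsum_of_gt_one (by lia)]
  push_cast
  rfl

theorem tsum_one_div_nat_pow_mem_zetaAlgebra {k w : ℕ} (hk : 2 ≤ k) (hkw : k ≤ w) :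
    ∑' n : ℕ, 1 / (n : ℝ) ^ k ∈ zetaAlgebra w := by
  refine Algebra.subset_adjoin (Or.inr ⟨0, k, by lia, by lia, by lia, by lia, ?_⟩)
  rw [zetaDeriv, iteratedDeriv_zero, Int.cast_natCast, ofReal_tsum_one_div_nat_pow hk,
    Complex.ofReal_re]

theorem log_two_mul_pi_mem_zetaAlgebra (w : ℕ) : Real.log (2 * Real.pi) ∈ zetaAlgebra w := by
  have h : zetaDeriv 1 0 ∈ zetaAlgebra w :=
    Algebra.subset_adjoin (Or.inr ⟨1, 0, by lia, by lia, by lia, by lia, rfl⟩)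
  have h2 : zetaDeriv 1 0 = -Real.log (2 * Real.pi) / 2 := by
    rw [zetaDeriv, iteratedDeriv_one, Int.cast_zero, deriv_riemannZeta_zero]
    have : Complex.log (2 * Real.pi) = ((Real.log (2 * Real.pi) : ℝ) : ℂ) := by
      rw [Complex.ofReal_log (by positivity)]
      push_cast
      rfl
    rw [this]
    norm_cast
  have h3 : Real.log (2 * Real.pi) = ((-2 : ℚ) : ℝ) * zetaDeriv 1 0 := by
    rw [h2]
    push_cast
    ring
  rw [h3]
  exact mul_mem (ratCast_mem_zetaAlgebra w _) h

theorem two_mul_pi_pow_mem_zetaAlgebra {w : ℕ} (hw : 2 ≤ w) {k : ℕ} (hk : Even k) :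
    (2 * Real.pi) ^ k ∈ zetaAlgebra w := by
  have hsq : Real.pi ^ 2 ∈ zetaAlgebra w := by
    have h := mul_mem (ratCast_mem_zetaAlgebra w 6)
      (tsum_one_div_nat_pow_mem_zetaAlgebra (le_refl 2) hw)
    rw [hasSum_zeta_two.tsum_eq] at h
    convert h using 1
    push_cast
    ring
  obtain ⟨j, rfl⟩ := hk
  have hcast : ((2 * Real.pi) ^ (j + j) : ℝ) = ((4 ^ j : ℚ) : ℝ) * (Real.pi ^ 2) ^ j := by
    rw [← two_mul, pow_mul]
    push_cast
    rw [← mul_pow]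
    ring
  rw [hcast]
  exact mul_mem (ratCast_mem_zetaAlgebra w _) (pow_mem hsq j)

/-! ### Reduction of the Tornheim series to first exponent one -/

/-- The general term `1 / (n^a m^b (n+m)^c)` of the Tornheim series. -/
noncomputable def tornheimTerm (a b c : ℕ) (p : ℕ+ × ℕ+) : ℝ :=
  1 / ((p.1 : ℝ) ^ a * (p.2 : ℝ) ^ b * ((p.1 : ℝ) + (p.2 : ℝ)) ^ c)

theorem summable_pnat_one_div_rpow {s : ℝ} (hs : 1 < s) :
    Summable fun n : ℕ+ => 1 / (n : ℝ) ^ s :=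
  (Real.summable_one_div_nat_rpow.mpr hs).comp_injective PNat.coe_injective

theorem summable_tornheimTerm_zero {a b : ℕ} (ha : 2 ≤ a) (hb : 2 ≤ b) :
    Summable (tornheimTerm a b 0) := by
  have h (k : ℕ) (hk : 2 ≤ k) : Summable fun n : ℕ+ => 1 / (n : ℝ) ^ k :=
    (Real.summable_one_div_nat_pow.mpr (by lia)).comp_injective PNat.coe_injective
  refine ((h a ha).mul_of_nonneg (h b hb) (fun n => by positivity) (fun n => by positivity)).congr
    fun p => ?_
  simp only [tornheimTerm, pow_zero, mul_one]
  rw [one_div_mul_one_div]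

theorem summable_tornheimTerm {a b c : ℕ} (ha : 0 < a) (hb : 0 < b) (hc : 0 < c) :
    Summable (tornheimTerm a b c) := by
  have h := summable_pnat_one_div_rpow (s := 3 / 2) (by norm_num)
  refine Summable.of_nonneg_of_le (fun p => by unfold tornheimTerm; positivity) (fun p => ?_)
    (h.mul_of_nonneg h (fun n => by positivity) (fun n => by positivity))
  obtain ⟨n, m⟩ := p
  have hn : (1 : ℝ) ≤ n := by exact_mod_cast n.pos
  have hm : (1 : ℝ) ≤ m := by exact_mod_cast m.pos
  simp only [tornheimTerm]
  rw [one_div_mul_one_div]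
  -- By the inequality of the means `√(n m) ≤ n + m`.
  have hamgm : (n : ℝ) ^ (1 / 2 : ℝ) * (m : ℝ) ^ (1 / 2 : ℝ) ≤ (n : ℝ) + m := by
    rw [← Real.sqrt_eq_rpow, ← Real.sqrt_eq_rpow]
    nlinarith [Real.sq_sqrt (show (0 : ℝ) ≤ n by linarith),
      Real.sq_sqrt (show (0 : ℝ) ≤ m by linarith), sq_nonneg (√(n : ℝ) - √(m : ℝ))]
  have hsplit (x : ℝ) (hx : 1 ≤ x) : x ^ (3 / 2 : ℝ) = x * x ^ (1 / 2 : ℝ) := by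
    rw [show (3 / 2 : ℝ) = 1 + 1 / 2 by norm_num, Real.rpow_add (by linarith), Real.rpow_one]
  refine one_div_le_one_div_of_le (by positivity) ?_
  rw [hsplit _ hn, hsplit _ hm]
  calc (n : ℝ) * (n : ℝ) ^ (1 / 2 : ℝ) * (m * (m : ℝ) ^ (1 / 2 : ℝ))
      = n * m * ((n : ℝ) ^ (1 / 2 : ℝ) * (m : ℝ) ^ (1 / 2 : ℝ)) := by ring
    _ ≤ n ^ 1 * m ^ 1 * (n + m) ^ 1 := by
        rw [pow_one, pow_one, pow_one]
        gcongr
    _ ≤ n ^ a * m ^ b * (n + m) ^ c := by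
        gcongr <;> linarith

theorem tornheim_eq_tsum {a b c : ℕ} (h : Summable (tornheimTerm a b c)) :
    tornheim a b c = ∑' p, tornheimTerm a b c p :=
  h.tsum_prod.symm

/-- The partial fraction step: `m = (n + m) - n`, divided by `n^(a+1) m^(b+1) (n+m)^(c+1)`. -/
theorem tornheim_succ_succ {a b c : ℕ} (h₁ : Summable (tornheimTerm (a + 1) (b + 1) c))
    (h₂ : Summable (tornheimTerm a (b + 1) (c + 1))) :
    tornheim (a + 1) b (c + 1) = tornheim (a + 1) (b + 1) c - tornheim a (b + 1) (c + 1) := by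
  have hterm : tornheimTerm (a + 1) b (c + 1) =
      fun p => tornheimTerm (a + 1) (b + 1) c p - tornheimTerm a (b + 1) (c + 1) p := by
    funext ⟨n, m⟩
    have hn : (0 : ℝ) < n := by exact_mod_cast n.pos
    have hm : (0 : ℝ) < m := by exact_mod_cast m.pos
    simp only [tornheimTerm]
    field_simp
    ring
  have h₃ : Summable (tornheimTerm (a + 1) b (c + 1)) := hterm ▸ h₁.sub h₂
  rw [tornheim_eq_tsum h₁, tornheim_eq_tsum h₂, tornheim_eq_tsum h₃, ← h₁.tsum_sub h₂, hterm]

theorem tsum_pnat_one_div_pow {k : ℕ} (hk : 0 < k) :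
    ∑' n : ℕ+, 1 / (n : ℝ) ^ k = ∑' n : ℕ, 1 / (n : ℝ) ^ k := by
  refine PNat.coe_injective.tsum_eq (f := fun n : ℕ => 1 / (n : ℝ) ^ k) fun n hn => ?_
  have : n ≠ 0 := by
    rintro rfl
    simp [hk.ne'] at hn
  exact ⟨⟨n, Nat.pos_of_ne_zero this⟩, rfl⟩

theorem tornheim_zero_mem_zetaAlgebra {a b w : ℕ} (ha : 2 ≤ a) (hb : 2 ≤ b) (haw : a ≤ w)
    (hbw : b ≤ w) : tornheim a b 0 ∈ zetaAlgebra w := by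
  have h : tornheim a b 0 = (∑' n : ℕ, 1 / (n : ℝ) ^ a) * ∑' n : ℕ, 1 / (n : ℝ) ^ b := by
    rw [← tsum_pnat_one_div_pow (by lia), ← tsum_pnat_one_div_pow (by lia), ← tsum_mul_right]
    unfold tornheim
    refine tsum_congr fun n => ?_
    rw [← tsum_mul_left]
    refine tsum_congr fun m => ?_
    rw [one_div_mul_one_div, pow_zero, mul_one]
  rw [h]
  exact mul_mem (tsum_one_div_nat_pow_mem_zetaAlgebra ha haw)
    (tsum_one_div_nat_pow_mem_zetaAlgebra hb hbw)

/-- Tornheim series reduce to those with first exponent `1`: each step lowers the first or the last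
exponent, and when the last exponent reaches `0` the series is a product of two zeta values. -/
theorem isRep_tornheim_of_one {w : ℕ}
    (base : ∀ b c, 0 < b → 0 < c → 1 + b + c = w → IsRep w (tornheim 1 b c)) :
    ∀ a b c, 0 < a → 0 < b → 0 < c → a + b + c = w → IsRep w (tornheim a b c) := by
  intro a b c ha
  induction a, ha using Nat.le_induction generalizing b c with
  | base => exact base b c
  | succ a ha iha =>
    induction c generalizing b with
    | zero => intro _ h; lia
    | succ c ihc =>
      intro hb _ hw
      rcases Nat.eq_zero_or_pos c with rfl | hc
      · rw [tornheim_succ_succ (summable_tornheimTerm_zero (by lia) (by lia))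
          (summable_tornheimTerm (by lia) (by lia) (by lia))]
        exact (IsRep.of_mem (tornheim_zero_mem_zetaAlgebra (by lia) (by lia) (by lia)
          (by lia))).sub (iha _ _ (by lia) (by lia) (by lia))
      · rw [tornheim_succ_succ (summable_tornheimTerm (by lia) (by lia) hc)
          (summable_tornheimTerm (by lia) (by lia) (by lia))]
        exact (ihc _ (by lia) hc (by lia)).sub (iha _ _ (by lia) (by lia) (by lia))

/-! ### Functions of logarithmic growth and Abel summation -/

/-- A function on the open interval `(0, 1)` with at most logarithmic growth at the endpoints: it is
bounded by every negative power of `q (1 - q)`. Such functions are closed under products and are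
integrable. -/
structure IsTame {E : Type*} [NormedAddCommGroup E] (f : ℝ → E) : Prop where
  aestronglyMeasurable : AEStronglyMeasurable f (volume.restrict (Ioo 0 1))
  exists_bound : ∀ ε : ℝ, 0 < ε → ∃ C : ℝ, ∀ q ∈ Ioo (0 : ℝ) 1, ‖f q‖ ≤ C * (q * (1 - q)) ^ (-ε)

theorem mul_one_sub_pos {q : ℝ} (hq : q ∈ Ioo (0 : ℝ) 1) : 0 < q * (1 - q) :=
  mul_pos hq.1 (sub_pos.mpr hq.2)

theorem one_le_mul_one_sub_rpow_neg {q ε : ℝ} (hq : q ∈ Ioo (0 : ℝ) 1) (hε : 0 < ε) :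
    1 ≤ (q * (1 - q)) ^ (-ε) :=
  Real.one_le_rpow_of_pos_of_le_one_of_nonpos (mul_one_sub_pos hq)
    (by nlinarith [hq.1, hq.2]) (by linarith)

theorem mul_mul_rpow_neg_half_le {q ε x y C D : ℝ} (hq : q ∈ Ioo (0 : ℝ) 1) (hy0 : 0 ≤ y)
    (hx : x ≤ C * (q * (1 - q)) ^ (-(ε / 2))) (hx0 : 0 ≤ x)
    (hy : y ≤ D * (q * (1 - q)) ^ (-(ε / 2))) :
    x * y ≤ C * D * (q * (1 - q)) ^ (-ε) := by
  calc x * y ≤ (C * (q * (1 - q)) ^ (-(ε / 2))) * (D * (q * (1 - q)) ^ (-(ε / 2))) :=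
        mul_le_mul hx hy hy0 (hx0.trans hx)
    _ = C * D * ((q * (1 - q)) ^ (-(ε / 2)) * (q * (1 - q)) ^ (-(ε / 2))) := by ring
    _ = _ := by
        rw [← Real.rpow_add (mul_one_sub_pos hq)]
        ring_nf

theorem intervalIntegrable_mul_one_sub_rpow :
    IntervalIntegrable (fun q : ℝ => (q * (1 - q)) ^ (-(1 / 2) : ℝ)) volume 0 1 := by
  have h := (Complex.betaIntegral_convergent (u := 1 / 2) (v := 1 / 2) (by norm_num)
    (by norm_num)).norm
  refine h.congr_uIoo fun q hq => ?_
  rw [uIoo_of_le zero_le_one] at hq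
  have h1 : (1 : ℂ) - q = ((1 - q : ℝ) : ℂ) := by push_cast; rfl
  simp only
  rw [norm_mul, h1, Complex.norm_cpow_eq_rpow_re_of_pos hq.1,
    Complex.norm_cpow_eq_rpow_re_of_pos (sub_pos.mpr hq.2),
    Real.mul_rpow hq.1.le (sub_pos.mpr hq.2).le]
  norm_num

namespace IsTame

variable {E : Type*} [NormedAddCommGroup E] {f g : ℝ → E}

theorem intervalIntegrable (hf : IsTame f) : IntervalIntegrable f volume 0 1 := by
  obtain ⟨C, hC⟩ := hf.exists_bound (1 / 2) (by norm_num)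
  rw [intervalIntegrable_iff_integrableOn_Ioo_of_le zero_le_one]
  have h := (intervalIntegrable_iff_integrableOn_Ioo_of_le zero_le_one).mp
    (intervalIntegrable_mul_one_sub_rpow.const_mul C)
  exact Integrable.mono' h hf.aestronglyMeasurable
    ((ae_restrict_mem measurableSet_Ioo).mono fun q hq => hC q hq)

theorem congr (hf : IsTame f) (h : ∀ q ∈ Ioo (0 : ℝ) 1, g q = f q) : IsTame g where
  aestronglyMeasurable := hf.aestronglyMeasurable.congr
    ((ae_restrict_mem measurableSet_Ioo).mono fun q hq => (h q hq).symm)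
  exists_bound ε hε := by
    obtain ⟨C, hC⟩ := hf.exists_bound ε hε
    exact ⟨C, fun q hq => by rw [h q hq]; exact hC q hq⟩

theorem of_continuousOn (hf : ContinuousOn f (Icc 0 1)) : IsTame f where
  aestronglyMeasurable :=
    (hf.mono Ioo_subset_Icc_self).aestronglyMeasurable measurableSet_Ioo
  exists_bound ε hε := by
    obtain ⟨C, hC⟩ := isCompact_Icc.exists_bound_of_continuousOn hf
    refine ⟨C, fun q hq => (hC q ⟨hq.1.le, hq.2.le⟩).trans ?_⟩
    have hC0 : 0 ≤ C := (norm_nonneg _).trans (hC q ⟨hq.1.le, hq.2.le⟩)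
    exact le_mul_of_one_le_right hC0 (one_le_mul_one_sub_rpow_neg hq hε)

theorem of_continuous (hf : Continuous f) : IsTame f :=
  of_continuousOn hf.continuousOn

theorem add (hf : IsTame f) (hg : IsTame g) : IsTame (fun q => f q + g q) where
  aestronglyMeasurable := hf.aestronglyMeasurable.add hg.aestronglyMeasurable
  exists_bound ε hε := by
    obtain ⟨C, hC⟩ := hf.exists_bound ε hε
    obtain ⟨D, hD⟩ := hg.exists_bound ε hε
    refine ⟨C + D, fun q hq => ?_⟩
    rw [add_mul]
    exact norm_add_le_of_le (hC q hq) (hD q hq)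

theorem mul {R : Type*} [NormedRing R] {f g : ℝ → R} (hf : IsTame f) (hg : IsTame g) :
    IsTame (fun q => f q * g q) where
  aestronglyMeasurable := hf.aestronglyMeasurable.mul hg.aestronglyMeasurable
  exists_bound ε hε := by
    obtain ⟨C, hC⟩ := hf.exists_bound (ε / 2) (by linarith)
    obtain ⟨D, hD⟩ := hg.exists_bound (ε / 2) (by linarith)
    exact ⟨C * D, fun q hq => (norm_mul_le _ _).trans
      (mul_mul_rpow_neg_half_le hq (norm_nonneg _) (hC q hq) (norm_nonneg _) (hD q hq))⟩

theorem const_mul {f : ℝ → ℝ} (c : ℝ) (hf : IsTame f) : IsTame (fun q => c * f q) :=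
  (of_continuous (continuous_const (y := c))).mul hf

theorem sub {f g : ℝ → ℝ} (hf : IsTame f) (hg : IsTame g) : IsTame (fun q => f q - g q) :=
  (hf.add (hg.const_mul (-1))).congr fun q _ => by ring

theorem comp_one_sub (hf : IsTame f) : IsTame (fun q => f (1 - q)) where
  aestronglyMeasurable := by
    have h := (Measure.measurePreserving_sub_left volume (1 : ℝ)).restrict_preimage
      (s := Ioo (0 : ℝ) 1) measurableSet_Ioo
    have hpre : (fun q : ℝ => 1 - q) ⁻¹' Ioo 0 1 = Ioo 0 1 := by simp
    rw [hpre] at h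
    exact hf.aestronglyMeasurable.comp_measurePreserving h
  exists_bound ε hε := by
    obtain ⟨C, hC⟩ := hf.exists_bound ε hε
    refine ⟨C, fun q hq => (hC (1 - q) ⟨by linarith [hq.2], by linarith [hq.1]⟩).trans ?_⟩
    rw [sub_sub_cancel, mul_comm (1 - q) q]

theorem re {f : ℝ → ℂ} (hf : IsTame f) : IsTame (fun q => (f q).re) where
  aestronglyMeasurable := hf.aestronglyMeasurable.re
  exists_bound ε hε := by
    obtain ⟨C, hC⟩ := hf.exists_bound ε hε
    exact ⟨C, fun q hq => (Complex.abs_re_le_norm _).trans (hC q hq)⟩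

theorem im {f : ℝ → ℂ} (hf : IsTame f) : IsTame (fun q => (f q).im) where
  aestronglyMeasurable := hf.aestronglyMeasurable.im
  exists_bound ε hε := by
    obtain ⟨C, hC⟩ := hf.exists_bound ε hε
    exact ⟨C, fun q hq => (Complex.abs_im_le_norm _).trans (hC q hq)⟩

end IsTame

/-- A family `F r`, `0 ≤ r < 1`, of continuous functions that tends to `f` on `(0, 1)` as `r → 1`,
with a bound of logarithmic growth at the endpoints that is uniform in `r`. The integrals over
`[0, 1]` then converge, also for products of such families. -/
structure IsAbelFamily (F : ℝ → ℝ → ℂ) (f : ℝ → ℂ) : Prop where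
  continuous : ∀ r ∈ Ico (0 : ℝ) 1, Continuous (F r)
  exists_bound : ∀ ε : ℝ, 0 < ε → ∃ C : ℝ, ∀ r ∈ Ico (0 : ℝ) 1, ∀ q ∈ Ioo (0 : ℝ) 1,
    ‖F r q‖ ≤ C * (q * (1 - q)) ^ (-ε)
  tendsto : ∀ q ∈ Ioo (0 : ℝ) 1, Tendsto (fun r => F r q) (𝓝[<] 1) (𝓝 (f q))

theorem eventually_mem_Ico_zero_one : ∀ᶠ r : ℝ in 𝓝[<] 1, r ∈ Ico (0 : ℝ) 1 :=
  Ico_mem_nhdsLT zero_lt_one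

namespace IsAbelFamily

variable {F G : ℝ → ℝ → ℂ} {f g : ℝ → ℂ}

theorem mul (hF : IsAbelFamily F f) (hG : IsAbelFamily G g) :
    IsAbelFamily (fun r q => F r q * G r q) (fun q => f q * g q) where
  continuous r hr := (hF.continuous r hr).mul (hG.continuous r hr)
  exists_bound ε hε := by
    obtain ⟨C, hC⟩ := hF.exists_bound (ε / 2) (by linarith)
    obtain ⟨D, hD⟩ := hG.exists_bound (ε / 2) (by linarith)
    refine ⟨C * D, fun r hr q hq => ?_⟩
    rw [norm_mul]
    exact mul_mul_rpow_neg_half_le hq (norm_nonneg _) (hC r hr q hq) (norm_nonneg _) (hD r hr q hq)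
  tendsto q hq := (hF.tendsto q hq).mul (hG.tendsto q hq)

theorem conj (hF : IsAbelFamily F f) :
    IsAbelFamily (fun r q => (starRingEnd ℂ) (F r q)) (fun q => (starRingEnd ℂ) (f q)) where
  continuous r hr := Complex.continuous_conj.comp (hF.continuous r hr)
  exists_bound ε hε := by
    obtain ⟨C, hC⟩ := hF.exists_bound ε hε
    exact ⟨C, fun r hr q hq => by rw [Complex.norm_conj]; exact hC r hr q hq⟩
  tendsto q hq := (Complex.continuous_conj.tendsto _).comp (hF.tendsto q hq)

theorem isTame (hF : IsAbelFamily F f) : IsTame f where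
  aestronglyMeasurable := by
    let r : ℕ → ℝ := fun n => 1 - 1 / ((n : ℝ) + 1)
    have hr (n : ℕ) : r n ∈ Ico (0 : ℝ) 1 := by
      have h : 1 / ((n : ℝ) + 1) ≤ 1 := by
        rw [div_le_one (by positivity)]
        linarith [(Nat.cast_nonneg n : (0 : ℝ) ≤ n)]
      have h' : 0 < 1 / ((n : ℝ) + 1) := by positivity
      exact ⟨by simp only [r]; linarith, by simp only [r]; linarith⟩
    have hlim : Tendsto r atTop (𝓝[<] 1) := by
      refine tendsto_nhdsWithin_iff.mpr ⟨?_, Eventually.of_forall fun n => (hr n).2⟩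
      have h : Tendsto r atTop (𝓝 (1 - 0)) :=
        tendsto_const_nhds.sub tendsto_one_div_add_atTop_nhds_zero_nat
      rwa [sub_zero] at h
    exact aestronglyMeasurable_of_tendsto_ae atTop
      (fun n => (hF.continuous _ (hr n)).aestronglyMeasurable)
      ((ae_restrict_mem measurableSet_Ioo).mono fun q hq => (hF.tendsto q hq).comp hlim)
  exists_bound ε hε := by
    obtain ⟨C, hC⟩ := hF.exists_bound ε hε
    refine ⟨C, fun q hq => le_of_tendsto (hF.tendsto q hq).norm ?_⟩
    filter_upwards [eventually_mem_Ico_zero_one] with r hr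
    exact hC r hr q hq

theorem tendsto_integral (hF : IsAbelFamily F f) :
    Tendsto (fun r => ∫ q in (0 : ℝ)..1, F r q) (𝓝[<] 1) (𝓝 (∫ q in (0 : ℝ)..1, f q)) := by
  obtain ⟨C, hC⟩ := hF.exists_bound (1 / 2) (by norm_num)
  have hne : ∀ᵐ q : ℝ, q ≠ 1 := by
    rw [ae_iff]
    simp
  refine intervalIntegral.tendsto_integral_filter_of_dominated_convergence
    (fun q => C * (q * (1 - q)) ^ (-(1 / 2) : ℝ)) ?_ ?_
    (intervalIntegrable_mul_one_sub_rpow.const_mul C) ?_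
  · filter_upwards [eventually_mem_Ico_zero_one] with r hr
    exact (hF.continuous r hr).aestronglyMeasurable
  · filter_upwards [eventually_mem_Ico_zero_one] with r hr
    filter_upwards [hne] with q hq1 hq
    rw [uIoc_of_le zero_le_one] at hq
    exact hC r hr q ⟨hq.1, lt_of_le_of_ne hq.2 hq1⟩
  · filter_upwards [hne] with q hq1 hq
    rw [uIoc_of_le zero_le_one] at hq
    exact hF.tendsto q ⟨hq.1, lt_of_le_of_ne hq.2 hq1⟩

end IsAbelFamily

/-! ### Polylogarithms on the unit circle -/

/-- The point `exp(2πiq)` of the unit circle. -/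
noncomputable def circlePoint (q : ℝ) : ℂ := Complex.exp (2 * Real.pi * Complex.I * q)

/-- The polylogarithm series `∑ zⁿ / n^a` over `n ≥ 1`; for `a ≥ 1` the term of index `0` is the junk
value `1 / 0 = 0`. -/
noncomputable def polylog (a : ℕ) (z : ℂ) : ℂ := ∑' n : ℕ, z ^ n / (n : ℂ) ^ a

/-- The polylogarithm on the unit circle, as a function of the angle `0 < q < 1`. For `a = 1` the
series converges only conditionally and is replaced by its sum `-log (1 - z)`. -/
noncomputable def circlePolylog (a : ℕ) (q : ℝ) : ℂ :=
  if a = 1 then -Complex.log (1 - circlePoint q) else polylog a (circlePoint q)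

theorem circlePoint_eq (q : ℝ) : circlePoint q =
    Complex.exp ((2 * Real.pi * q : ℝ) * Complex.I) := by
  unfold circlePoint
  push_cast
  ring_nf

theorem norm_circlePoint (q : ℝ) : ‖circlePoint q‖ = 1 := by
  rw [circlePoint_eq, Complex.norm_exp_ofReal_mul_I]

theorem continuous_circlePoint : Continuous circlePoint := by
  unfold circlePoint
  fun_prop

theorem conj_circlePoint (q : ℝ) : (starRingEnd ℂ) (circlePoint q) = circlePoint (-q) := by
  rw [circlePoint_eq, circlePoint_eq, ← Complex.exp_conj, map_mul, Complex.conj_ofReal,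
    Complex.conj_I]
  simp

theorem norm_pow_div_natCast_pow_le {a : ℕ} (z : ℂ) (n : ℕ) :
    ‖z ^ n / (n : ℂ) ^ a‖ ≤ ‖z‖ ^ n := by
  rw [norm_div, norm_pow, norm_pow, Complex.norm_natCast]
  rcases Nat.eq_zero_or_pos n with rfl | hn
  · rcases Nat.eq_zero_or_pos a with rfl | ha
    · simp
    · simp [ha.ne']
  · exact div_le_self (by positivity) (one_le_pow₀ (by exact_mod_cast hn))

theorem summable_pow_div_natCast_pow {a : ℕ} {z : ℂ} (hz : ‖z‖ < 1) :
    Summable fun n : ℕ => z ^ n / (n : ℂ) ^ a :=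
  Summable.of_norm_bounded (summable_geometric_of_lt_one (norm_nonneg z) hz)
    (norm_pow_div_natCast_pow_le z)

theorem polylog_one {z : ℂ} (hz : ‖z‖ < 1) : polylog 1 z = -Complex.log (1 - z) := by
  simpa [polylog] using (Complex.hasSum_taylorSeries_neg_log hz).tsum_eq

theorem norm_polylog_le {a : ℕ} (ha : 2 ≤ a) {z : ℂ} (hz : ‖z‖ ≤ 1) :
    ‖polylog a z‖ ≤ ∑' n : ℕ, 1 / (n : ℝ) ^ a := by
  refine tsum_of_norm_bounded (Real.summable_one_div_nat_pow.mpr (by lia)).hasSum fun n => ?_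
  rw [norm_div, norm_pow, norm_pow, Complex.norm_natCast]
  gcongr
  exact pow_le_one₀ (norm_nonneg _) hz

theorem norm_ofReal_mul_circlePoint {r : ℝ} (hr : 0 ≤ r) (q : ℝ) :
    ‖(r : ℂ) * circlePoint q‖ = r := by
  rw [norm_mul, norm_circlePoint, mul_one, Complex.norm_of_nonneg hr]

theorem norm_one_sub_circlePoint (q : ℝ) : ‖1 - circlePoint q‖ = |2 * Real.sin (Real.pi * q)| := by
  rw [norm_sub_rev, circlePoint_eq, mul_comm _ Complex.I, Complex.norm_exp_I_mul_ofReal_sub_one,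
    Real.norm_eq_abs, show 2 * Real.pi * q / 2 = Real.pi * q by ring]

theorem mul_one_sub_le_sin {q : ℝ} (hq : q ∈ Ioo (0 : ℝ) 1) :
    q * (1 - q) ≤ Real.sin (Real.pi * q) := by
  have key (x : ℝ) (hx0 : 0 ≤ x) (hx : x ≤ 1 / 2) : x ≤ Real.sin (Real.pi * x) := by
    have h := Real.mul_le_sin (x := Real.pi * x) (by positivity) (by nlinarith [Real.pi_pos])
    have : 2 / Real.pi * (Real.pi * x) = 2 * x := by field_simp
    linarith
  rcases le_total q (1 / 2) with h | h
  · have := key q hq.1.le h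
    nlinarith [hq.1, hq.2]
  · have := key (1 - q) (by linarith [hq.2]) (by linarith)
    rw [show Real.pi * (1 - q) = Real.pi - Real.pi * q by ring, Real.sin_pi_sub] at this
    nlinarith [hq.1, hq.2]

theorem neg_log_le_rpow_neg_div {x ε : ℝ} (hx : 0 < x) (hε : 0 < ε) :
    -Real.log x ≤ x ^ (-ε) / ε := by
  have h := Real.log_le_rpow_div (inv_nonneg.mpr hx.le) hε
  rwa [Real.log_inv, Real.inv_rpow hx.le, ← Real.rpow_neg hx.le] at h

/-- This bound is uniform in the radius `r` and so dominates the family `Li_1(r z)` as `r → 1`. -/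
theorem norm_log_one_sub_le {r q : ℝ} (hr : r ∈ Ico (0 : ℝ) 1) (hq : q ∈ Ioo (0 : ℝ) 1) :
    ‖Complex.log (1 - r * circlePoint q)‖ ≤ Real.log 2 + Real.pi - Real.log (q * (1 - q)) := by
  have hz := norm_ofReal_mul_circlePoint hr.1 q
  have hpos := mul_one_sub_pos hq
  have hsin := mul_one_sub_le_sin hq
  -- `|1 - z| ≤ |1 - r z| + (1 - r) ≤ 2 |1 - r z|`.
  have hlow : q * (1 - q) ≤ ‖1 - r * circlePoint q‖ := by
    have h1 : ‖1 - circlePoint q‖ ≤ ‖1 - r * circlePoint q‖ + (1 - r) := by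
      have h := norm_sub_le (1 - r * circlePoint q) ((1 - r : ℝ) * circlePoint q)
      rwa [norm_ofReal_mul_circlePoint (by linarith [hr.2]),
        show 1 - r * circlePoint q - ((1 - r : ℝ) : ℂ) * circlePoint q = 1 - circlePoint q by
          push_cast; ring] at h
    have h2 : 1 - r ≤ ‖1 - r * circlePoint q‖ := by
      have h := norm_sub_norm_le 1 (r * circlePoint q)
      rwa [hz, norm_one] at h
    rw [norm_one_sub_circlePoint, abs_of_pos (by linarith)] at h1
    linarith
  have hup : ‖1 - r * circlePoint q‖ ≤ 2 := by
    have h := norm_sub_le 1 (r * circlePoint q)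
    rw [hz, norm_one] at h
    linarith [hr.2]
  have hlog1 := Real.log_le_log hpos hlow
  have hlog2 := Real.log_le_log (hpos.trans_le hlow) hup
  have hle0 : Real.log (q * (1 - q)) ≤ 0 :=
    Real.log_nonpos hpos.le (by nlinarith [hq.1, hq.2])
  have hl2 : 0 ≤ Real.log 2 := Real.log_nonneg (by norm_num)
  have h := Complex.norm_le_abs_re_add_abs_im (Complex.log (1 - r * circlePoint q))
  rw [Complex.log_re, Complex.log_im] at h
  have harg := Complex.abs_arg_le_pi (1 - r * circlePoint q)
  have habs : |Real.log ‖1 - r * circlePoint q‖| ≤ Real.log 2 - Real.log (q * (1 - q)) :=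
    abs_le.mpr ⟨by linarith, by linarith⟩
  linarith

theorem one_sub_circlePoint_mem_slitPlane {q : ℝ} (hq : q ∈ Ioo (0 : ℝ) 1) :
    1 - circlePoint q ∈ Complex.slitPlane := by
  refine Or.inl ?_
  have hsin := mul_one_sub_le_sin hq
  have hpos := mul_one_sub_pos hq
  rw [circlePoint_eq, Complex.sub_re, Complex.exp_ofReal_mul_I_re, Complex.one_re,
    show 2 * Real.pi * q = 2 * (Real.pi * q) by ring, Real.cos_two_mul']
  nlinarith [Real.sin_sq_add_cos_sq (Real.pi * q)]

/-- Abel summation for the polylogarithms on the unit circle. -/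
theorem isAbelFamily_polylog {a : ℕ} (ha : 0 < a) :
    IsAbelFamily (fun r q => polylog a (r * circlePoint q)) (circlePolylog a) where
  continuous r hr := by
    refine continuous_tsum (fun n => ?_) (summable_geometric_of_lt_one hr.1 hr.2) fun n q => ?_
    · exact ((continuous_const.mul continuous_circlePoint).pow n).div_const _
    · have h := norm_pow_div_natCast_pow_le (a := a) (r * circlePoint q) n
      rwa [norm_ofReal_mul_circlePoint hr.1] at h
  exists_bound ε hε := by
    rcases eq_or_ne a 1 with rfl | ha1
    · refine ⟨Real.log 2 + Real.pi + 1 / ε, fun r hr q hq => ?_⟩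
      have hz := norm_ofReal_mul_circlePoint hr.1 q
      rw [polylog_one (by rw [hz]; exact hr.2), norm_neg]
      have h1 := norm_log_one_sub_le hr hq
      have h2 := neg_log_le_rpow_neg_div (mul_one_sub_pos hq) hε
      have h3 := one_le_mul_one_sub_rpow_neg hq hε
      have hl2 : 0 ≤ Real.log 2 := Real.log_nonneg (by norm_num)
      have h4 := le_mul_of_one_le_right (add_nonneg hl2 Real.pi_pos.le) h3
      rw [add_mul, one_div, inv_mul_eq_div]
      linarith
    · refine ⟨∑' n : ℕ, 1 / (n : ℝ) ^ a, fun r hr q hq => ?_⟩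
      refine (norm_polylog_le (by lia)
        ((norm_ofReal_mul_circlePoint hr.1 q).trans_le hr.2.le)).trans ?_
      exact le_mul_of_one_le_right (tsum_nonneg fun n => by positivity)
        (one_le_mul_one_sub_rpow_neg hq hε)
  tendsto q hq := by
    have hz : Tendsto (fun r : ℝ => (r : ℂ) * circlePoint q) (𝓝[<] 1) (𝓝 (circlePoint q)) := by
      have h : Continuous fun r : ℝ => (r : ℂ) * circlePoint q := by fun_prop
      have h' := h.tendsto 1
      rw [Complex.ofReal_one, one_mul] at h'
      exact h'.mono_left nhdsWithin_le_nhds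
    unfold circlePolylog
    split_ifs with ha1
    · subst ha1
      refine (((tendsto_const_nhds.sub hz).clog (one_sub_circlePoint_mem_slitPlane hq)).neg).congr'
        ?_
      filter_upwards [eventually_mem_Ico_zero_one] with r hr
      rw [polylog_one (by rw [norm_ofReal_mul_circlePoint hr.1]; exact hr.2)]
    · refine tendsto_tsum_of_dominated_convergence
        (Real.summable_one_div_nat_pow.mpr (show 1 < a by lia)) (fun n => (hz.pow n).div_const _) ?_
      filter_upwards [eventually_mem_Ico_zero_one] with r hr n
      rw [norm_div, norm_pow, norm_pow, Complex.norm_natCast, norm_ofReal_mul_circlePoint hr.1]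
      gcongr
      exact pow_le_one₀ hr.1 hr.2.le

/-- Inside the disc the polylogarithm series can be integrated term by term against any continuous
function. -/
theorem integral_polylog_mul {a : ℕ} {r : ℝ} (hr : r ∈ Ico (0 : ℝ) 1) (G : ℝ → ℂ)
    (hG : Continuous G) :
    ∫ q in (0 : ℝ)..1, polylog a (r * circlePoint q) * G q =
      ∑' n : ℕ, (r : ℂ) ^ n / (n : ℂ) ^ a * ∫ q in (0 : ℝ)..1, circlePoint q ^ n * G q := by
  have hsum (q : ℝ) : HasSum (fun n : ℕ => (r : ℂ) ^ n / (n : ℂ) ^ a * (circlePoint q ^ n * G q))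
      (polylog a (r * circlePoint q) * G q) := by
    have hz := norm_ofReal_mul_circlePoint hr.1 q
    refine ((summable_pow_div_natCast_pow (a := a) (by rw [hz]; exact hr.2)).hasSum.mul_right
      (G q)).congr_fun fun n => ?_
    rw [mul_pow]
    ring
  have h := intervalIntegral.hasSum_integral_of_dominated_convergence (μ := volume)
    (a := (0 : ℝ)) (b := 1)
    (F := fun (n : ℕ) q => (r : ℂ) ^ n / (n : ℂ) ^ a * (circlePoint q ^ n * G q))
    (f := fun q => polylog a (r * circlePoint q) * G q)
    (fun (n : ℕ) q => r ^ n * ‖G q‖)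
    (fun n => (continuous_const.mul
      ((continuous_circlePoint.pow n).mul hG)).aestronglyMeasurable)
    (fun n => Eventually.of_forall fun q _ => ?_)
    (Eventually.of_forall fun q _ => (summable_geometric_of_lt_one hr.1 hr.2).mul_right _)
    ?_ (Eventually.of_forall fun q _ => hsum q)
  · rw [← h.tsum_eq]
    exact tsum_congr fun n => (intervalIntegral.integral_const_mul
      ((r : ℂ) ^ n / (n : ℂ) ^ a) fun q => circlePoint q ^ n * G q)
  · rw [norm_mul, norm_mul, norm_pow, norm_circlePoint, one_pow, one_mul]
    gcongr
    have h := norm_pow_div_natCast_pow_le (a := a) (r : ℂ) n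
    rwa [Complex.norm_of_nonneg hr.1] at h
  · simp_rw [tsum_mul_right]
    exact (continuous_const.mul hG.norm).intervalIntegrable 0 1

theorem integral_circlePoint_pow (n : ℕ) :
    ∫ q in (0 : ℝ)..1, circlePoint q ^ n = if n = 0 then 1 else 0 := by
  split_ifs with h
  · simp [h]
  · have hc : (n : ℂ) * (2 * Real.pi * Complex.I) ≠ 0 := by
      simp [h, Real.pi_ne_zero]
    have he (q : ℝ) : circlePoint q ^ n =
        Complex.exp ((n : ℂ) * (2 * Real.pi * Complex.I) * q) := by
      rw [circlePoint, ← Complex.exp_nat_mul]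
      ring_nf
    simp_rw [he]
    rw [integral_exp_mul_complex hc]
    have : Complex.exp ((n : ℂ) * (2 * Real.pi * Complex.I)) = 1 :=
      Complex.exp_nat_mul_two_pi_mul_I n
    simp [this]

theorem circlePoint_mul_conj (q : ℝ) :
    circlePoint q * (starRingEnd ℂ) (circlePoint q) = 1 := by
  rw [Complex.mul_conj, Complex.normSq_eq_norm_sq, norm_circlePoint]
  simp

theorem integral_circlePoint_pow_mul_conj (n k : ℕ) :
    ∫ q in (0 : ℝ)..1, circlePoint q ^ n * (starRingEnd ℂ) (circlePoint q ^ k) =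
      if n = k then 1 else 0 := by
  rcases le_total k n with h | h
  · obtain ⟨j, rfl⟩ := Nat.exists_eq_add_of_le h
    have he (q : ℝ) : circlePoint q ^ (k + j) * (starRingEnd ℂ) (circlePoint q ^ k) =
        circlePoint q ^ j := by
      rw [map_pow, pow_add, mul_right_comm, ← mul_pow, circlePoint_mul_conj, one_pow, one_mul]
    simp_rw [he, integral_circlePoint_pow]
    simp
  · obtain ⟨j, rfl⟩ := Nat.exists_eq_add_of_le h
    have he (q : ℝ) : circlePoint q ^ n * (starRingEnd ℂ) (circlePoint q ^ (n + j)) =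
        (starRingEnd ℂ) (circlePoint q ^ j) := by
      rw [map_pow, map_pow, pow_add, ← mul_assoc, ← mul_pow, circlePoint_mul_conj, one_pow, one_mul]
    simp_rw [he]
    have hconj : ∫ q in (0 : ℝ)..1, (starRingEnd ℂ) (circlePoint q ^ j) =
        (starRingEnd ℂ) (∫ q in (0 : ℝ)..1, circlePoint q ^ j) := by
      simp_rw [intervalIntegral.integral_of_le zero_le_one]
      exact integral_conj
    rw [hconj, integral_circlePoint_pow]
    rcases Nat.eq_zero_or_pos j with rfl | hj
    · simp
    · simp [hj.ne']

theorem continuous_polylog_circlePoint {a : ℕ} (ha : 0 < a) {r : ℝ} (hr : r ∈ Ico (0 : ℝ) 1) :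
    Continuous fun q => polylog a (r * circlePoint q) :=
  (isAbelFamily_polylog ha).continuous r hr

theorem integral_polylog_mul_circlePoint_pow {b : ℕ} (hb : 0 < b) {r : ℝ}
    (hr : r ∈ Ico (0 : ℝ) 1) (k : ℕ) :
    ∫ q in (0 : ℝ)..1, polylog b (r * circlePoint q) * circlePoint q ^ k = 0 := by
  rw [integral_polylog_mul hr (fun q => circlePoint q ^ k) (continuous_circlePoint.pow k)]
  simp_rw [← pow_add, integral_circlePoint_pow]
  refine (tsum_congr fun n => ?_).trans tsum_zero
  rcases Nat.eq_zero_or_pos n with rfl | hn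
  · simp [hb.ne']
  · simp [hn.ne']

theorem integral_circlePoint_pow_mul_conj_polylog {c : ℕ} {r : ℝ}
    (hr : r ∈ Ico (0 : ℝ) 1) (k : ℕ) :
    ∫ q in (0 : ℝ)..1, circlePoint q ^ k * (starRingEnd ℂ) (polylog c (r * circlePoint q)) =
      (r : ℂ) ^ k / (k : ℂ) ^ c := by
  have h := integral_polylog_mul (a := c) hr (fun q => (starRingEnd ℂ) (circlePoint q ^ k))
    (Complex.continuous_conj.comp (continuous_circlePoint.pow k))
  simp_rw [integral_circlePoint_pow_mul_conj, mul_ite, mul_one, mul_zero, tsum_ite_eq] at h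
  have h' := congrArg (starRingEnd ℂ) h
  simp_rw [intervalIntegral.integral_of_le zero_le_one] at h' ⊢
  rw [← integral_conj] at h'
  simp only [map_mul, Complex.conj_conj, map_div₀, map_pow, Complex.conj_ofReal,
    Complex.conj_natCast] at h'
  rw [← h']
  simp only [mul_comm]

theorem tsum_nat_eq_tsum_pnat {f : ℕ → ℂ} (h : f 0 = 0) : ∑' n : ℕ, f n = ∑' n : ℕ+, f n := by
  refine (PNat.coe_injective.tsum_eq fun n hn => ?_).symm
  have : n ≠ 0 := by
    rintro rfl
    exact hn h
  exact ⟨⟨n, Nat.pos_of_ne_zero this⟩, rfl⟩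

section FourierCoefficients

variable {a b c : ℕ}

theorem integral_circlePolylog (ha : 0 < a) : ∫ q in (0 : ℝ)..1, circlePolylog a q = 0 := by
  refine tendsto_nhds_unique (isAbelFamily_polylog ha).tendsto_integral
    (tendsto_const_nhds.congr' ?_)
  filter_upwards [eventually_mem_Ico_zero_one] with r hr
  simpa using (integral_polylog_mul_circlePoint_pow ha hr 0).symm

theorem integral_circlePolylog_mul (ha : 0 < a) (hb : 0 < b) :
    ∫ q in (0 : ℝ)..1, circlePolylog a q * circlePolylog b q = 0 := by
  refine tendsto_nhds_unique
    ((isAbelFamily_polylog ha).mul (isAbelFamily_polylog hb)).tendsto_integral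
    (tendsto_const_nhds.congr' ?_)
  filter_upwards [eventually_mem_Ico_zero_one] with r hr
  rw [integral_polylog_mul hr _ (continuous_polylog_circlePoint hb hr)]
  simp_rw [mul_comm (circlePoint _ ^ _), integral_polylog_mul_circlePoint_pow hb hr]
  simp

theorem integral_circlePolylog_mul_mul (ha : 0 < a) (hb : 0 < b) (hc : 0 < c) :
    ∫ q in (0 : ℝ)..1, circlePolylog a q * (circlePolylog b q * circlePolylog c q) = 0 := by
  refine tendsto_nhds_unique ((isAbelFamily_polylog ha).mul
    ((isAbelFamily_polylog hb).mul (isAbelFamily_polylog hc))).tendsto_integral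
    (tendsto_const_nhds.congr' ?_)
  filter_upwards [eventually_mem_Ico_zero_one] with r hr
  have hcb := continuous_polylog_circlePoint hb hr
  have hcc := continuous_polylog_circlePoint hc hr
  rw [integral_polylog_mul hr (fun q => polylog b (r * circlePoint q) *
    polylog c (r * circlePoint q)) (hcb.mul hcc)]
  simp_rw [mul_left_comm (circlePoint _ ^ _)]
  refine ((tsum_congr fun n => ?_).trans tsum_zero).symm
  rw [integral_polylog_mul hr (fun q => circlePoint q ^ n * polylog c (r * circlePoint q))
    ((continuous_circlePoint.pow n).mul hcc)]
  simp_rw [← mul_assoc, ← pow_add, mul_comm (circlePoint _ ^ _),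
    integral_polylog_mul_circlePoint_pow hc hr]
  simp

theorem integral_circlePolylog_mul_conj (ha : 0 < a) (hb : 0 < b) :
    ∫ q in (0 : ℝ)..1, circlePolylog a q * (starRingEnd ℂ) (circlePolylog b q) =
      ((∑' n : ℕ, 1 / (n : ℝ) ^ (a + b) : ℝ) : ℂ) := by
  refine tendsto_nhds_unique ((isAbelFamily_polylog ha).mul
    (isAbelFamily_polylog hb).conj).tendsto_integral ?_
  have hlim : Tendsto (fun r : ℝ => ∑' n : ℕ, (r : ℂ) ^ (2 * n) / (n : ℂ) ^ (a + b)) (𝓝[<] 1)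
      (𝓝 (∑' n : ℕ, 1 / (n : ℂ) ^ (a + b))) := by
    refine tendsto_tsum_of_dominated_convergence
      (Real.summable_one_div_nat_pow.mpr (show 1 < a + b by lia)) (fun n => ?_) ?_
    · have h : Continuous fun r : ℝ => (r : ℂ) ^ (2 * n) / (n : ℂ) ^ (a + b) := by fun_prop
      simpa using (h.tendsto 1).mono_left nhdsWithin_le_nhds
    · filter_upwards [eventually_mem_Ico_zero_one] with r hr n
      rw [norm_div, norm_pow, norm_pow, Complex.norm_natCast, Complex.norm_of_nonneg hr.1]
      gcongr
      exact pow_le_one₀ hr.1 hr.2.le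
  push_cast
  refine hlim.congr' ?_
  filter_upwards [eventually_mem_Ico_zero_one] with r hr
  have hcb := Complex.continuous_conj.comp (continuous_polylog_circlePoint hb hr)
  rw [integral_polylog_mul hr (fun q => (starRingEnd ℂ) (polylog b (r * circlePoint q))) hcb]
  refine tsum_congr fun n => ?_
  rw [integral_circlePoint_pow_mul_conj_polylog hr, div_mul_div_comm, ← pow_add, ← pow_add, two_mul]

/-- The Tornheim series as the constant Fourier coefficient of a product of polylogarithms. -/
theorem integral_circlePolylog_mul_mul_conj (ha : 0 < a) (hb : 0 < b) (hc : 0 < c) :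
    ∫ q in (0 : ℝ)..1,
      circlePolylog a q * (circlePolylog b q * (starRingEnd ℂ) (circlePolylog c q)) =
      (tornheim a b c : ℂ) := by
  refine tendsto_nhds_unique ((isAbelFamily_polylog ha).mul
    ((isAbelFamily_polylog hb).mul (isAbelFamily_polylog hc).conj)).tendsto_integral ?_
  have hsum := summable_tornheimTerm ha hb hc
  have hbound : ∀ r ∈ Ico (0 : ℝ) 1, ∀ p : ℕ+ × ℕ+,
      ‖(r : ℂ) ^ (2 * (p.1 + p.2 : ℕ)) * (tornheimTerm a b c p : ℂ)‖ ≤ tornheimTerm a b c p := by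
    intro r hr p
    have h0 : 0 ≤ tornheimTerm a b c p := by unfold tornheimTerm; positivity
    rw [norm_mul, norm_pow, Complex.norm_of_nonneg hr.1, Complex.norm_of_nonneg h0]
    exact mul_le_of_le_one_left h0 (pow_le_one₀ hr.1 hr.2.le)
  have hlim : Tendsto
      (fun r : ℝ => ∑' p : ℕ+ × ℕ+, (r : ℂ) ^ (2 * (p.1 + p.2 : ℕ)) * (tornheimTerm a b c p : ℂ))
      (𝓝[<] 1) (𝓝 (∑' p : ℕ+ × ℕ+, (tornheimTerm a b c p : ℂ))) := by
    refine tendsto_tsum_of_dominated_convergence hsum (fun p => ?_) ?_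
    · have h : Continuous fun r : ℝ =>
        (r : ℂ) ^ (2 * (p.1 + p.2 : ℕ)) * (tornheimTerm a b c p : ℂ) := by fun_prop
      simpa using (h.tendsto 1).mono_left nhdsWithin_le_nhds
    · filter_upwards [eventually_mem_Ico_zero_one] with r hr p using hbound r hr p
  rw [tornheim_eq_tsum hsum, Complex.ofReal_tsum]
  refine hlim.congr' ?_
  filter_upwards [eventually_mem_Ico_zero_one] with r hr
  have hcb := continuous_polylog_circlePoint hb hr
  have hcc := Complex.continuous_conj.comp (continuous_polylog_circlePoint hc hr)
  rw [integral_polylog_mul hr (fun q => polylog b (r * circlePoint q) *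
    (starRingEnd ℂ) (polylog c (r * circlePoint q))) (hcb.mul hcc)]
  have hinner (n : ℕ) : ∫ q in (0 : ℝ)..1, circlePoint q ^ n * (polylog b (r * circlePoint q) *
      (starRingEnd ℂ) (polylog c (r * circlePoint q))) =
      ∑' m : ℕ, (r : ℂ) ^ m / (m : ℂ) ^ b * ((r : ℂ) ^ (n + m) / ((n + m : ℕ) : ℂ) ^ c) := by
    simp_rw [mul_left_comm (circlePoint _ ^ _)]
    rw [integral_polylog_mul hr (fun q => circlePoint q ^ n *
      (starRingEnd ℂ) (polylog c (r * circlePoint q))) ((continuous_circlePoint.pow n).mul hcc)]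
    refine tsum_congr fun m => ?_
    simp_rw [← mul_assoc, ← pow_add]
    rw [integral_circlePoint_pow_mul_conj_polylog hr, add_comm m n]
  simp_rw [hinner]
  have hsum' : Summable fun p : ℕ+ × ℕ+ =>
      (r : ℂ) ^ (2 * (p.1 + p.2 : ℕ)) * (tornheimTerm a b c p : ℂ) :=
    Summable.of_norm_bounded hsum (hbound r hr)
  rw [hsum'.tsum_prod, tsum_nat_eq_tsum_pnat (by simp [ha.ne'])]
  refine tsum_congr fun n => ?_
  rw [tsum_nat_eq_tsum_pnat (by simp [hb.ne']), ← tsum_mul_left]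
  refine tsum_congr fun m => ?_
  simp only [tornheimTerm]
  have hn : (n : ℂ) ≠ 0 := by exact_mod_cast n.ne_zero
  have hm : (m : ℂ) ≠ 0 := by exact_mod_cast m.ne_zero
  have hnm : (n : ℂ) + m ≠ 0 := by exact_mod_cast (n + m).ne_zero
  push_cast
  field_simp
  ring

end FourierCoefficients

/-! ### Lerch's formula -/

theorem norm_ofReal_cpow_sub_le {x y : ℝ} (hx : 0 < x) (hxy : x ≤ y) {w : ℂ} (hw : w.re ≤ 1) :
    ‖(y : ℂ) ^ w - (x : ℂ) ^ w‖ ≤ ‖w‖ * x ^ (w.re - 1) * (y - x) := by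
  have hderiv : ∀ t ∈ Set.Icc x y,
      HasDerivWithinAt (fun t : ℝ => (t : ℂ) ^ w) (w * (t : ℂ) ^ (w - 1)) (Set.Icc x y) t := by
    intro t ht
    have ht0 : 0 < t := hx.trans_le ht.1
    have h := ((hasDerivAt_id (t : ℂ)).cpow_const (c := w)
      (Or.inl (by simpa using ht0))).comp_ofReal
    simpa using h.hasDerivWithinAt
  have h := norm_image_sub_le_of_norm_deriv_le_segment' hderiv
    (C := ‖w‖ * x ^ (w.re - 1)) (fun t ht => ?_) y (Set.right_mem_Icc.mpr hxy)
  · exact h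
  · have ht0 : 0 < t := hx.trans_le ht.1
    rw [norm_mul, Complex.norm_cpow_eq_rpow_re_of_pos ht0]
    gcongr
    simp only [Complex.sub_re, Complex.one_re]
    exact Real.rpow_le_rpow_of_nonpos hx ht.1 (by linarith)

/-- The summands of the regularised Hurwitz series
`ζ(s, q) - ζ(s) + (q - 1) s ζ(s + 1)`, which converges for `Re s > -1`. The entire function
`riemannZeta₁ (s + 1)` stands for `s ζ(s + 1)`, so that the value at `s = 0` is the right one. -/
noncomputable def hurwitzRegTerm (q : ℝ) (n : ℕ) (s : ℂ) : ℂ :=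
  ((n : ℂ) + q) ^ (-s) - ((n : ℂ) + 1) ^ (-s) + (q - 1) * (s * ((n : ℂ) + 1) ^ (-s - 1))

theorem differentiable_hurwitzRegTerm {q : ℝ} (hq : 0 < q) (n : ℕ) :
    Differentiable ℂ (hurwitzRegTerm q n) := by
  have h1 : (n : ℂ) + q ≠ 0 := by
    have : (0 : ℝ) < n + q := by positivity
    exact_mod_cast this.ne'
  have h2 : (n : ℂ) + 1 ≠ 0 := Nat.cast_add_one_ne_zero n
  unfold hurwitzRegTerm
  refine Differentiable.add (.sub ?_ ?_) (.const_mul (.mul differentiable_id ?_) _)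
  · exact (differentiable_id.neg).const_cpow (Or.inl h1)
  · exact (differentiable_id.neg).const_cpow (Or.inl h2)
  · exact (differentiable_id.neg.sub_const 1).const_cpow (Or.inl h2)

/-- The ball is centred at `1` so as to contain both `0`, where the derivative is wanted, and `2`,
near which the Dirichlet series converge. The factor `q^(-5)` comes from `n + q ≥ q (n + 1)`. -/
theorem norm_hurwitzRegTerm_le {q : ℝ} (hq : 0 < q) (hq1 : q ≤ 1) (n : ℕ) {s : ℂ}
    (hs : s ∈ Metric.ball (1 : ℂ) (3 / 2)) :
    ‖hurwitzRegTerm q n s‖ ≤ 10 * q ^ (-5 : ℝ) * (1 / ((n : ℝ) + 1) ^ (3 / 2 : ℝ)) := by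
  rw [Metric.mem_ball, dist_eq_norm] at hs
  have hre := (Complex.abs_re_le_norm (s - 1)).trans_lt hs
  rw [Complex.sub_re, Complex.one_re, abs_lt] at hre
  have hn0 : (0 : ℝ) ≤ n := Nat.cast_nonneg n
  have hns : ‖s‖ ≤ 5 / 2 := by
    have := norm_add_le (s - 1) 1
    rw [sub_add_cancel, norm_one] at this
    linarith
  have hns1 : ‖-s - 1‖ ≤ 4 := by
    rw [show -s - 1 = -(s - 1) - 2 by ring]
    have := norm_sub_le (-(s - 1)) 2
    rw [norm_neg] at this
    have h2 : ‖(2 : ℂ)‖ = 2 := by simp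
    linarith
  -- `x ↦ (n+x)^(-s) - (n+1)^(-s) + s (x-1) (n+1)^(-s-1)` vanishes to second order at `x = 1`.
  let φ : ℝ → ℂ := fun x =>
    ((n + x : ℝ) : ℂ) ^ (-s) + ((x : ℂ) - 1) * (s * ((n : ℂ) + 1) ^ (-s - 1))
  have hφ : hurwitzRegTerm q n s = -(φ 1 - φ q) := by
    simp only [φ, hurwitzRegTerm]
    push_cast
    ring
  have hderiv : ∀ t ∈ Set.Icc q 1, HasDerivWithinAt φ
      (-s * (((n + t : ℝ) : ℂ) ^ (-s - 1) - ((n + 1 : ℝ) : ℂ) ^ (-s - 1))) (Set.Icc q 1) t := by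
    intro t ht
    have ht0 : 0 < n + t := by linarith [ht.1]
    have h := ((hasDerivAt_id ((t : ℂ))).const_add (n : ℂ)).cpow_const (c := -s)
      (Or.inl (by simp; exact ht0))
    have h' := (((hasDerivAt_id ((t : ℂ))).sub_const (1 : ℂ)).mul_const
      (s * ((n : ℂ) + 1) ^ (-s - 1)))
    refine ((h.add h').comp_ofReal.hasDerivWithinAt.congr_deriv ?_).congr (fun x _ => ?_) ?_
    · simp; ring
    · simp [φ]
    · simp [φ]
  have hbound : ∀ t ∈ Set.Ico q 1,
      ‖-s * (((n + t : ℝ) : ℂ) ^ (-s - 1) - ((n + 1 : ℝ) : ℂ) ^ (-s - 1))‖ ≤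
        10 * q ^ (-5 : ℝ) * (1 / ((n : ℝ) + 1) ^ (3 / 2 : ℝ)) := by
    intro t ht
    have ht0 : 0 < n + t := by linarith [ht.1]
    have h := norm_ofReal_cpow_sub_le ht0 (show n + t ≤ n + 1 by linarith [ht.2])
      (w := -s - 1) (by simp; linarith)
    rw [norm_mul, norm_neg, norm_sub_rev]
    have hle : (n + t) ^ ((-s - 1).re - 1) ≤ q ^ (-5 : ℝ) * (1 / ((n : ℝ) + 1) ^ (3 / 2 : ℝ)) := by
      have hre2 : (-s - 1).re - 1 = -s.re - 2 := by simp; ring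
      rw [hre2]
      calc (n + t) ^ (-s.re - 2) ≤ (q * (n + 1)) ^ (-s.re - 2) := by
            refine Real.rpow_le_rpow_of_nonpos (by positivity) ?_ (by linarith)
            nlinarith [ht.1]
        _ = q ^ (-s.re - 2) * ((n : ℝ) + 1) ^ (-s.re - 2) :=
            Real.mul_rpow hq.le (by positivity)
        _ ≤ q ^ (-5 : ℝ) * ((n : ℝ) + 1) ^ (-(3 / 2) : ℝ) := by
            gcongr ?_ * ?_
            · exact Real.rpow_le_rpow_of_exponent_ge hq hq1 (by linarith)
            · exact Real.rpow_le_rpow_of_exponent_le (by linarith) (by linarith)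
        _ = _ := by rw [Real.rpow_neg (show (0 : ℝ) ≤ n + 1 by positivity), one_div]
    have hq5 : 0 ≤ q ^ (-5 : ℝ) * (1 / ((n : ℝ) + 1) ^ (3 / 2 : ℝ)) := by positivity
    calc _ ≤ 5 / 2 * (4 * (q ^ (-5 : ℝ) * (1 / ((n : ℝ) + 1) ^ (3 / 2 : ℝ))) * 1) := by
          gcongr
          refine h.trans ?_
          gcongr
          · linarith [ht.2]
          · linarith [ht.1]
      _ = _ := by ring
  have h := norm_image_sub_le_of_norm_deriv_le_segment' hderiv hbound 1 (Set.right_mem_Icc.mpr hq1)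
  rw [hφ, norm_neg]
  refine h.trans ?_
  refine mul_le_of_le_one_right (by positivity) (by linarith)

theorem summable_one_div_succ_rpow_three_halves :
    Summable fun n : ℕ => 1 / ((n : ℝ) + 1) ^ (3 / 2 : ℝ) := by
  have h := (summable_nat_add_iff 1).mpr (Real.summable_one_div_nat_rpow.mpr
    (show (1 : ℝ) < 3 / 2 by norm_num))
  exact_mod_cast h

theorem tsum_hurwitzRegTerm_of_one_lt_re {q : ℝ} (hq : 0 < q) (hq1 : q ≤ 1) {s : ℂ}
    (hs : 1 < s.re) :
    ∑' n, hurwitzRegTerm q n s = HurwitzZeta.hurwitzZeta (q : UnitAddCircle) s -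
      HurwitzZeta.hurwitzZeta (0 : UnitAddCircle) s + (q - 1) * riemannZeta₁ (s + 1) := by
  have h1 := HurwitzZeta.hasSum_hurwitzZeta_of_one_lt_re (a := q) ⟨hq.le, hq1⟩ hs
  have h2 := HurwitzZeta.hasSum_hurwitzZeta_of_one_lt_re (a := 1) ⟨zero_le_one, le_refl _⟩ hs
  have h3 := HurwitzZeta.hasSum_hurwitzZeta_of_one_lt_re (a := 1) ⟨zero_le_one, le_refl _⟩
    (s := s + 1) (by simp; linarith)
  have hone : ((1 : ℝ) : UnitAddCircle) = 0 := by
    exact AddCircle.coe_period (1 : ℝ)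
  have hs0 : s ≠ 0 := by
    rintro rfl
    simp at hs
    linarith
  have hz : riemannZeta₁ (s + 1) = s * riemannZeta (s + 1) := by
    rw [riemannZeta_eq_inv_sub_mul (by simpa using hs0)]
    field_simp
    simp
    field_simp
  rw [hone] at h2 h3
  rw [hz, ← congrFun HurwitzZeta.hurwitzZeta_zero (s + 1)]
  refine (((h1.sub h2).add ((h3.mul_left s).mul_left ((q : ℂ) - 1))).congr_fun fun n => ?_).tsum_eq
  simp only [hurwitzRegTerm, Complex.ofReal_one, one_div, ← Complex.cpow_neg]
  rw [neg_add']

theorem tsum_hurwitzRegTerm {q : ℝ} (hq : 0 < q) (hq1 : q ≤ 1) :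
    Set.EqOn (fun s => ∑' n, hurwitzRegTerm q n s)
      (fun s => HurwitzZeta.hurwitzZeta (q : UnitAddCircle) s -
        HurwitzZeta.hurwitzZeta (0 : UnitAddCircle) s + (q - 1) * riemannZeta₁ (s + 1))
      (Metric.ball (1 : ℂ) (3 / 2)) := by
  have hdiff : DifferentiableOn ℂ (fun s => ∑' n, hurwitzRegTerm q n s)
      (Metric.ball (1 : ℂ) (3 / 2)) :=
    Complex.differentiableOn_tsum_of_summable_norm
      (summable_one_div_succ_rpow_three_halves.mul_left (10 * q ^ (-5 : ℝ)))
      (fun n => (differentiable_hurwitzRegTerm hq n).differentiableOn) Metric.isOpen_ball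
      (fun n s hs => norm_hurwitzRegTerm_le hq hq1 n hs)
  have hdiff2 : Differentiable ℂ (fun s => HurwitzZeta.hurwitzZeta (q : UnitAddCircle) s -
      HurwitzZeta.hurwitzZeta (0 : UnitAddCircle) s + (q - 1) * riemannZeta₁ (s + 1)) :=
    (HurwitzZeta.differentiable_hurwitzZeta_sub_hurwitzZeta _ _).add
      ((differentiable_riemannZeta₁.comp (differentiable_id.add_const 1)).const_mul _)
  refine (hdiff.analyticOnNhd Metric.isOpen_ball).eqOn_of_preconnected_of_eventuallyEq
    (hdiff2.differentiableOn.analyticOnNhd Metric.isOpen_ball)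
    (convex_ball (1 : ℂ) (3 / 2)).isPreconnected (z₀ := 2) ?_ ?_
  · rw [Metric.mem_ball, dist_eq_norm]
    norm_num
  · have : {s : ℂ | 1 < s.re} ∈ 𝓝 (2 : ℂ) :=
      (isOpen_lt continuous_const Complex.continuous_re).mem_nhds (by simp)
    filter_upwards [this] with s hs
    exact tsum_hurwitzRegTerm_of_one_lt_re hq hq1 hs

theorem deriv_hurwitzRegTerm_zero {q : ℝ} (hq : 0 < q) (n : ℕ) :
    deriv (hurwitzRegTerm q n) 0 =
      ((Real.log (n + 1) - Real.log (q + n) + (q - 1) * ((n : ℝ) + 1)⁻¹ : ℝ) : ℂ) := by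
  have hpos : (0 : ℝ) < n + q := by positivity
  have h1 : (n : ℂ) + q ≠ 0 := by exact_mod_cast hpos.ne'
  have h2 : (n : ℂ) + 1 ≠ 0 := Nat.cast_add_one_ne_zero n
  have hneg : HasDerivAt (fun s : ℂ => -s) (-1) 0 := hasDerivAt_neg 0
  have d1 := hneg.const_cpow (c := (n : ℂ) + q) (Or.inl h1)
  have d2 := hneg.const_cpow (c := (n : ℂ) + 1) (Or.inl h2)
  have d3 := (hasDerivAt_id (0 : ℂ)).mul
    ((hneg.sub_const 1).const_cpow (c := (n : ℂ) + 1) (Or.inl h2))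
  have d := (d1.sub d2).add (d3.const_mul ((q : ℂ) - 1))
  have e1 : Complex.log ((n : ℂ) + q) = (Real.log (q + n) : ℝ) := by
    rw [Complex.ofReal_log (by positivity)]
    push_cast
    rw [add_comm]
  have e2 : Complex.log ((n : ℂ) + 1) = (Real.log (n + 1) : ℝ) := by
    rw [Complex.ofReal_log (by positivity)]
    push_cast
    rfl
  refine (HasDerivAt.congr_deriv (f := hurwitzRegTerm q n) d ?_).deriv
  rw [e1, e2]
  simp [Complex.cpow_neg_one]
  ring

theorem tendsto_sum_log_gamma_series {q : ℝ} (hq : 0 < q) :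
    Tendsto (fun N : ℕ => ∑ n ∈ Finset.range N,
      (Real.log (n + 1) - Real.log (q + n) + (q - 1) * ((n : ℝ) + 1)⁻¹)) atTop
      (𝓝 (Real.log (Real.Gamma q) + (q - 1) * Real.eulerMascheroniConstant)) := by
  rw [← tendsto_add_atTop_iff_nat 1]
  have hG := Real.BohrMollerup.tendsto_log_gamma hq
  have hH := (tendsto_add_atTop_iff_nat 1).mpr Real.tendsto_harmonic_sub_log
  have hL : Tendsto (fun N : ℕ => Real.log ((N : ℝ) + 1) - Real.log N) atTop (𝓝 0) := by
    exact Real.tendsto_log_nat_add_one_sub_log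
  have h := (hG.add (hH.const_mul (q - 1))).add (hL.const_mul q)
  rw [mul_zero, add_zero] at h
  refine h.congr fun N => ?_
  have hfac (M : ℕ) : Real.log (M.factorial : ℝ) =
      ∑ n ∈ Finset.range M, Real.log ((n : ℝ) + 1) := by
    induction M with
    | zero => simp
    | succ M ih =>
      rw [Finset.sum_range_succ, ← ih, Nat.factorial_succ, Nat.cast_mul,
        Real.log_mul (by positivity) (by positivity)]
      push_cast
      ring
  have hfac' : Real.log (N.factorial : ℝ) =
      (∑ n ∈ Finset.range (N + 1), Real.log ((n : ℝ) + 1)) - Real.log ((N : ℝ) + 1) := by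
    rw [Finset.sum_range_succ, hfac]
    ring
  have hharm : ((harmonic (N + 1) : ℚ) : ℝ) =
      ∑ n ∈ Finset.range (N + 1), ((n : ℝ) + 1)⁻¹ := by
    rw [harmonic]
    push_cast
    rfl
  rw [Real.BohrMollerup.logGammaSeq, hfac', hharm, Finset.sum_add_distrib,
    Finset.sum_sub_distrib, ← Finset.mul_sum]
  push_cast
  ring

/-- **Lerch's formula** `ζ'(0, q) = ln Γ(q) + ζ'(0)`. -/
theorem deriv_hurwitzZeta_zero {q : ℝ} (hq : 0 < q) (hq1 : q ≤ 1) :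
    deriv (HurwitzZeta.hurwitzZeta (q : UnitAddCircle)) 0 =
      ((Real.log (Real.Gamma q) - Real.log (2 * Real.pi) / 2 : ℝ) : ℂ) := by
  have h0 : (0 : ℂ) ∈ Metric.ball (1 : ℂ) (3 / 2) := by
    rw [Metric.mem_ball, dist_eq_norm]
    norm_num
  have hsum := Complex.hasSum_deriv_of_summable_norm
    (summable_one_div_succ_rpow_three_halves.mul_left (10 * q ^ (-5 : ℝ)))
    (fun n => (differentiable_hurwitzRegTerm hq n).differentiableOn) Metric.isOpen_ball
    (fun n s hs => norm_hurwitzRegTerm_le hq hq1 n hs) h0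
  rw [((tsum_hurwitzRegTerm hq hq1).eventuallyEq_of_mem
    (Metric.isOpen_ball.mem_nhds h0)).deriv_eq] at hsum
  simp_rw [deriv_hurwitzRegTerm_zero hq] at hsum
  have hlim := tendsto_nhds_unique hsum.tendsto_sum_nat
    (((Complex.continuous_ofReal.tendsto _).comp (tendsto_sum_log_gamma_series hq)).congr
      fun N => by simp only [Function.comp_apply, Complex.ofReal_sum])
  have hd1 := (HurwitzZeta.differentiableAt_hurwitzZeta (q : UnitAddCircle)
    (s := 0) zero_ne_one).hasDerivAt
  have hd2 := (HurwitzZeta.differentiableAt_hurwitzZeta (0 : UnitAddCircle)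
    (s := 0) zero_ne_one).hasDerivAt
  have hd3 : HasDerivAt (fun s : ℂ => riemannZeta₁ (s + 1)) (deriv riemannZeta₁ (0 + 1)) 0 :=
    (differentiable_riemannZeta₁ (0 + 1)).hasDerivAt.comp_add_const 0 1
  have hd : deriv (fun s => HurwitzZeta.hurwitzZeta (q : UnitAddCircle) s -
      HurwitzZeta.hurwitzZeta (0 : UnitAddCircle) s + (q - 1) * riemannZeta₁ (s + 1)) 0 = _ :=
    ((hd1.sub hd2).add (hd3.const_mul ((q : ℂ) - 1))).deriv
  have hlog : Complex.log (2 * Real.pi) = ((Real.log (2 * Real.pi) : ℝ) : ℂ) := by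
    rw [Complex.ofReal_log (by positivity)]
    push_cast
    rfl
  have := hd.symm.trans hlim
  rw [zero_add, deriv_riemannZeta₁_one, HurwitzZeta.hurwitzZeta_zero, deriv_riemannZeta_zero,
    hlog] at this
  push_cast at this ⊢
  linear_combination this

/-! ### Bernoulli polynomials and Clausen functions as parts of the polylogarithms -/

theorem summable_pow_div_natCast_pow_of_norm_le_one {m : ℕ} (hm : 2 ≤ m) {z : ℂ} (hz : ‖z‖ ≤ 1) :
    Summable fun n : ℕ => z ^ n / (n : ℂ) ^ m := by
  refine Summable.of_norm_bounded
    (Real.summable_one_div_nat_pow.mpr (show 1 < m by lia)) fun n => ?_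
  rw [norm_div, norm_pow, norm_pow, Complex.norm_natCast]
  gcongr
  exact pow_le_one₀ (norm_nonneg _) hz

theorem circlePoint_pow_div (q : ℝ) (n m : ℕ) :
    circlePoint q ^ n / (n : ℂ) ^ m =
      ((1 / (n : ℝ) ^ m * Real.cos (2 * Real.pi * n * q) : ℝ) : ℂ) +
        ((1 / (n : ℝ) ^ m * Real.sin (2 * Real.pi * n * q) : ℝ) : ℂ) * Complex.I := by
  rw [circlePoint_eq, ← Complex.exp_nat_mul, ← mul_assoc, ← Complex.ofReal_natCast,
    ← Complex.ofReal_mul, Complex.exp_mul_I, ← Complex.ofReal_cos, ← Complex.ofReal_sin,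
    show (n : ℝ) * (2 * Real.pi * q) = 2 * Real.pi * n * q by ring]
  push_cast
  ring

theorem hasSum_re_polylog {m : ℕ} (hm : 2 ≤ m) (q : ℝ) :
    HasSum (fun n : ℕ => 1 / (n : ℝ) ^ m * Real.cos (2 * Real.pi * n * q))
      (polylog m (circlePoint q)).re := by
  refine (Complex.hasSum_re (summable_pow_div_natCast_pow_of_norm_le_one hm
    (norm_circlePoint q).le).hasSum).congr_fun fun n => ?_
  rw [circlePoint_pow_div, Complex.add_re, Complex.ofReal_re, Complex.re_ofReal_mul, Complex.I_re,
    mul_zero, add_zero]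

theorem hasSum_im_polylog {m : ℕ} (hm : 2 ≤ m) (q : ℝ) :
    HasSum (fun n : ℕ => 1 / (n : ℝ) ^ m * Real.sin (2 * Real.pi * n * q))
      (polylog m (circlePoint q)).im := by
  refine (Complex.hasSum_im (summable_pow_div_natCast_pow_of_norm_le_one hm
    (norm_circlePoint q).le).hasSum).congr_fun fun n => ?_
  rw [circlePoint_pow_div, Complex.add_im, Complex.ofReal_im, Complex.im_ofReal_mul, Complex.I_im,
    mul_one, zero_add]

/-- The real or imaginary part of `Li_m(exp(2πiq))`, according to the parity of `m`, that is a
multiple of the Bernoulli polynomial `B_m(q)`. -/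
noncomputable def bernoulliPart (m : ℕ) (q : ℝ) : ℝ :=
  if Even m then (circlePolylog m q).re else (circlePolylog m q).im

/-- The other part of `Li_m(exp(2πiq))`: the Clausen function of order `m`. -/
noncomputable def clausenPart (m : ℕ) (q : ℝ) : ℝ :=
  if Even m then (circlePolylog m q).im else (circlePolylog m q).re

theorem one_sub_circlePoint (q : ℝ) :
    1 - circlePoint q = ((2 * Real.sin (Real.pi * q) : ℝ) : ℂ) *
      (Complex.cos ((Real.pi * q - Real.pi / 2 : ℝ) : ℂ) +
        Complex.sin ((Real.pi * q - Real.pi / 2 : ℝ) : ℂ) * Complex.I) := by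
  rw [circlePoint_eq, Complex.exp_mul_I, ← Complex.ofReal_cos, ← Complex.ofReal_sin,
    ← Complex.ofReal_cos, ← Complex.ofReal_sin, Real.cos_sub_pi_div_two, Real.sin_sub_pi_div_two,
    show 2 * Real.pi * q = 2 * (Real.pi * q) by ring, Real.sin_two_mul, Real.cos_two_mul]
  have h := congrArg Complex.ofReal (Real.sin_sq_add_cos_sq (Real.pi * q))
  rw [Complex.ofReal_add, Complex.ofReal_pow, Complex.ofReal_pow, Complex.ofReal_one] at h
  simp only [Complex.ofReal_sub, Complex.ofReal_mul, Complex.ofReal_neg, Complex.ofReal_pow,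
    Complex.ofReal_one, Complex.ofReal_ofNat]
  linear_combination (-2 : ℂ) * h

theorem bernoulliPart_one {q : ℝ} (hq : q ∈ Ioo (0 : ℝ) 1) :
    bernoulliPart 1 q = Real.pi * (1 / 2 - q) := by
  have hsin : 0 < Real.sin (Real.pi * q) :=
    (mul_one_sub_pos hq).trans_le (mul_one_sub_le_sin hq)
  have hpi := Real.pi_pos
  rw [bernoulliPart, if_neg (by decide), circlePolylog, if_pos rfl, Complex.neg_im,
    Complex.log_im, one_sub_circlePoint, Complex.arg_mul_cos_add_sin_mul_I (by positivity)
      ⟨by nlinarith [hq.1], by nlinarith [hq.2]⟩]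
  ring

theorem clausenPart_one {q : ℝ} (hq : q ∈ Ioo (0 : ℝ) 1) :
    clausenPart 1 q = -Real.log (2 * Real.sin (Real.pi * q)) := by
  have hsin : 0 < Real.sin (Real.pi * q) :=
    (mul_one_sub_pos hq).trans_le (mul_one_sub_le_sin hq)
  rw [clausenPart, if_neg (by decide), circlePolylog, if_pos rfl, Complex.neg_re,
    Complex.log_re, norm_one_sub_circlePoint, Real.log_abs]

/-- The Fourier expansion of the Bernoulli polynomials; only the rationality of the factor
matters. -/
theorem exists_bernoulliPart_eq {m : ℕ} (hm : 0 < m) :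
    ∃ ε : ℚ, ε ≠ 0 ∧ ∀ q ∈ Ioo (0 : ℝ) 1,
      bernoulliPart m q = ε * (2 * Real.pi) ^ m * bernoulliFun m q := by
  obtain ⟨k, rfl | rfl⟩ := Nat.even_or_odd' m
  · refine ⟨(-1) ^ (k + 1) / 2 / ((2 * k).factorial : ℚ), by positivity, fun q hq => ?_⟩
    rw [bernoulliPart, if_pos (even_two_mul k), circlePolylog, if_neg (by lia),
      (hasSum_re_polylog (by lia) q).unique
        (hasSum_one_div_nat_pow_mul_cos (by lia) ⟨hq.1.le, hq.2.le⟩), bernoulliFun]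
    push_cast
    ring
  · rcases Nat.eq_zero_or_pos k with rfl | hk
    · refine ⟨-1 / 2, by norm_num, fun q hq => ?_⟩
      rw [mul_zero, zero_add, bernoulliPart_one hq, bernoulliFun_one]
      push_cast
      ring
    · refine ⟨(-1) ^ (k + 1) / 2 / ((2 * k + 1).factorial : ℚ), by positivity, fun q hq => ?_⟩
      rw [bernoulliPart, if_neg (by simp), circlePolylog, if_neg (by lia),
        (hasSum_im_polylog (by lia) q).unique
          (hasSum_one_div_nat_pow_mul_sin (by lia) ⟨hq.1.le, hq.2.le⟩), bernoulliFun]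
      push_cast
      ring

theorem conj_polylog (m : ℕ) (z : ℂ) :
    (starRingEnd ℂ) (polylog m z) = polylog m ((starRingEnd ℂ) z) := by
  simp [polylog, Complex.conj_tsum]

theorem expZeta_natCast {m : ℕ} (hm : 2 ≤ m) (q : ℝ) :
    HurwitzZeta.expZeta (q : UnitAddCircle) m = polylog m (circlePoint q) := by
  rw [polylog, ← (HurwitzZeta.hasSum_expZeta_of_one_lt_re q (s := m)
    (by simp; lia)).tsum_eq]
  refine tsum_congr fun n => ?_
  rw [Complex.cpow_natCast, circlePoint, ← Complex.exp_nat_mul]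
  ring_nf

/-- The derivative of the functional equation of the Hurwitz zeta function at a positive integer.
Only the part of it that does not involve `c = d/ds ((2π)^(-s) Γ(s))` is needed explicitly. -/
theorem exists_deriv_hurwitzZeta_one_sub {m : ℕ} (hm : 2 ≤ m) : ∃ c : ℂ, ∀ x : UnitAddCircle,
    deriv (HurwitzZeta.hurwitzZeta x) (1 - m) =
      -(c * ((-Complex.I) ^ m * HurwitzZeta.expZeta x m +
          Complex.I ^ m * HurwitzZeta.expZeta (-x) m) +
        ((2 * Real.pi) ^ (-(m : ℤ)) * ((m - 1).factorial : ℂ)) *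
          ((-Complex.I) ^ m * (-(Real.pi * Complex.I / 2) * HurwitzZeta.expZeta x m +
              deriv (HurwitzZeta.expZeta x) m) +
            Complex.I ^ m * (Real.pi * Complex.I / 2 * HurwitzZeta.expZeta (-x) m +
              deriv (HurwitzZeta.expZeta (-x)) m))) := by
  have hre (s : ℂ) (hs : 1 < s.re) (n : ℕ) : s ≠ -n := by
    rintro rfl
    simp at hs
    linarith [(Nat.cast_nonneg n : (0 : ℝ) ≤ n)]
  have hm1 : 1 < (m : ℂ).re := by
    simp
    lia
  have hmne : (m : ℂ) ≠ 1 := by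
    intro h
    rw [h] at hm1
    simp at hm1
  have h2pi : (2 * Real.pi : ℂ) ≠ 0 := by simp [Real.pi_ne_zero]
  let u : ℂ → ℂ := fun s => (2 * Real.pi : ℂ) ^ (-s) * Complex.Gamma s
  have hu : DifferentiableAt ℂ u m :=
    ((differentiableAt_id.neg).const_cpow (Or.inl h2pi)).mul
      (Complex.differentiableAt_Gamma _ (hre _ hm1))
  have hum : u m = (2 * Real.pi) ^ (-(m : ℤ)) * ((m - 1).factorial : ℂ) := by
    simp only [u]
    rw [← Complex.Gamma_nat_eq_factorial, zpow_neg, zpow_natCast, Complex.cpow_neg,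
      Complex.cpow_natCast, Nat.cast_sub (by lia)]
    simp
  refine ⟨deriv u m, fun x => ?_⟩
  have hE (y : UnitAddCircle) := (HurwitzZeta.differentiableAt_expZeta y m (Or.inl hmne)).hasDerivAt
  have hexp (t : ℂ) : HasDerivAt (fun s : ℂ => Complex.exp (t * s / 2))
      (Complex.exp (t * m / 2) * (t / 2)) m := by
    have h := (((hasDerivAt_id (m : ℂ)).const_mul t).div_const 2).cexp
    simpa using h
  have e1 : Complex.exp (-Real.pi * Complex.I * m / 2) = (-Complex.I) ^ m := by
    rw [show -Real.pi * Complex.I * m / 2 = m * (-Real.pi / 2 * Complex.I) by ring,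
      Complex.exp_nat_mul, Complex.exp_neg_pi_div_two_mul_I]
  have e2 : Complex.exp (Real.pi * Complex.I * m / 2) = Complex.I ^ m := by
    rw [show Real.pi * Complex.I * m / 2 = m * (Real.pi / 2 * Complex.I) by ring,
      Complex.exp_nat_mul, Complex.exp_pi_div_two_mul_I]
  have hd := hu.hasDerivAt.mul
    (((hexp (-Real.pi * Complex.I)).mul (hE x)).add ((hexp (Real.pi * Complex.I)).mul (hE (-x))))
  have heq : (fun s => HurwitzZeta.hurwitzZeta x (1 - s)) =ᶠ[𝓝 (m : ℂ)] fun s =>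
      u s * (Complex.exp (-Real.pi * Complex.I * s / 2) * HurwitzZeta.expZeta x s +
        Complex.exp (Real.pi * Complex.I * s / 2) * HurwitzZeta.expZeta (-x) s) := by
    filter_upwards [(isOpen_lt continuous_const Complex.continuous_re).mem_nhds hm1] with s hs
    refine HurwitzZeta.hurwitzZeta_one_sub x (hre s hs) (Or.inr ?_)
    rintro rfl
    simp at hs
  have hd' := (hd.congr_of_eventuallyEq heq).deriv
  rw [deriv_comp_const_sub, neg_eq_iff_eq_neg] at hd'
  rw [hd']
  simp only [Pi.add_apply, Pi.mul_apply]
  rw [e1, e2, hum]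
  ring

/-- In the combination `A_m(q) - (-1)^m A_m(1 - q)` the derivatives of the exponential zeta function
and of `(2π)^(-s) Γ(s)` cancel; what remains comes from the factors `exp(∓πis/2)`. -/
theorem bernoulliA_sub {m : ℕ} (hm : 2 ≤ m) (q : ℝ) :
    bernoulliA m q - (-1) ^ m * bernoulliA m (1 - q) =
      -(2 * Real.pi) * (2 * Real.pi) ^ (-(m : ℤ)) * m.factorial *
        ((-Complex.I) ^ m * polylog m (circlePoint q)).im := by
  obtain ⟨c, hc⟩ := exists_deriv_hurwitzZeta_one_sub hm
  have hneg : ((1 - q : ℝ) : UnitAddCircle) = -(q : UnitAddCircle) := by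
    have hone : ((1 : ℝ) : UnitAddCircle) = 0 := AddCircle.coe_period (1 : ℝ)
    rw [AddCircle.coe_sub, hone, zero_sub]
  have hE : HurwitzZeta.expZeta (-(q : UnitAddCircle)) m =
      (starRingEnd ℂ) (polylog m (circlePoint q)) := by
    rw [← AddCircle.coe_neg, expZeta_natCast hm, conj_polylog, conj_circlePoint]
  have hI : (Complex.I : ℂ) ^ m = (-1) ^ m * (-Complex.I) ^ m := by
    rw [← mul_pow]
    simp
  have hone : ((-1 : ℂ) ^ m) * (-1) ^ m = 1 := by
    rw [← mul_pow]
    simp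
  have hconj : (starRingEnd ℂ) ((-Complex.I) ^ m * polylog m (circlePoint q)) =
      Complex.I ^ m * (starRingEnd ℂ) (polylog m (circlePoint q)) := by
    simp
  have hfac : (m.factorial : ℝ) = m * ((m - 1).factorial : ℝ) := by
    rw [← Nat.mul_factorial_pred (by lia : m ≠ 0)]
    push_cast
    rfl
  have hdiff : deriv (HurwitzZeta.hurwitzZeta (q : UnitAddCircle)) (1 - m) -
      (-1) ^ m * deriv (HurwitzZeta.hurwitzZeta ((1 - q : ℝ) : UnitAddCircle)) (1 - m) =
      ((-(2 * Real.pi) * ((2 * Real.pi) ^ (-(m : ℤ)) * ((m - 1).factorial : ℝ)) *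
        ((-Complex.I) ^ m * polylog m (circlePoint q)).im : ℝ) : ℂ) := by
    have him := Complex.sub_conj ((-Complex.I) ^ m * polylog m (circlePoint q))
    rw [hconj] at him
    rw [hneg, hc, hc, neg_neg, hE, expZeta_natCast hm]
    push_cast
    set v : ℂ := (2 * Real.pi) ^ (-(m : ℤ)) * ((m - 1).factorial : ℂ)
    set z := polylog m (circlePoint q)
    set z' := (starRingEnd ℂ) z
    set J := (-Complex.I) ^ m
    set y : ℂ := ((J * z).im : ℂ)
    have key : (Complex.I ^ m : ℂ) = (-1) ^ m * J := hI
    rw [key] at him ⊢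
    have him' : J * z - (-1) ^ m * J * z' = 2 * y * Complex.I := by
      rw [him]
      push_cast
      ring
    generalize (-1 : ℂ) ^ m = σ at *
    have hII := Complex.I_mul_I
    linear_combination (Real.pi * Complex.I * v) * him' + (2 * Real.pi * v * y) * hII +
      (c * J * z - v * J * (-(Real.pi * Complex.I / 2 * z)) +
        v * J * deriv (HurwitzZeta.expZeta (q : UnitAddCircle)) m) * hone
  have hre := congrArg Complex.re hdiff
  rw [Complex.sub_re, Complex.ofReal_re,
    show ((-1 : ℂ) ^ m) = (((-1 : ℝ) ^ m : ℝ) : ℂ) by push_cast; rfl, Complex.re_ofReal_mul] at hre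
  unfold bernoulliA
  rw [hfac]
  linear_combination (m : ℝ) * hre

/-- The harmonic number does not enter, because `B_m(1 - q) = (-1)^m B_m(q)`. -/
theorem negapolygamma_sub {m : ℕ} (q : ℝ) :
    negapolygamma m q - (-1) ^ m * negapolygamma m (1 - q) =
      (bernoulliA m q - (-1) ^ m * bernoulliA m (1 - q)) / m.factorial := by
  have hone : ((-1 : ℝ) ^ m) * (-1) ^ m = 1 := by
    rw [← mul_pow]
    simp
  unfold negapolygamma
  rw [bernoulliFun_eval_one_sub]
  linear_combination ((harmonic (m - 1) : ℝ) * bernoulliFun m q / m.factorial) * hone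

theorem negapolygamma_one {q : ℝ} (hq : q ∈ Ioo (0 : ℝ) 1) :
    negapolygamma 1 q = logGamma q - Real.log (2 * Real.pi) / 2 := by
  simp only [negapolygamma, bernoulliA, logGamma]
  simp only [Nat.cast_one, sub_self]
  rw [deriv_hurwitzZeta_zero hq.1 hq.2.le, Complex.ofReal_re]
  simp

/-- Euler's reflection formula, in the form `C_1(q) = ln Γ(q) + ln Γ(1 - q) - ln (2π)`. -/
theorem clausenPart_one_eq_logGamma {q : ℝ} (hq : q ∈ Ioo (0 : ℝ) 1) :
    clausenPart 1 q = logGamma q + logGamma (1 - q) - Real.log (2 * Real.pi) := by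
  have hsin : 0 < Real.sin (Real.pi * q) :=
    (mul_one_sub_pos hq).trans_le (mul_one_sub_le_sin hq)
  rw [clausenPart_one hq, logGamma, logGamma, ← Real.log_mul (Real.Gamma_pos_of_pos hq.1).ne'
    (Real.Gamma_pos_of_pos (sub_pos.mpr hq.2)).ne', Real.Gamma_mul_Gamma_one_sub,
    Real.log_div Real.pi_ne_zero hsin.ne', Real.log_mul two_ne_zero hsin.ne',
    Real.log_mul two_ne_zero Real.pi_ne_zero]
  ring

/-- The Clausen function is the part of the balanced negapolygamma function that has the parity
opposite to that of `B_m` under `q ↦ 1 - q`, up to a rational multiple of `π^(m-1)`. -/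
theorem exists_clausenPart_eq {m : ℕ} (hm : 0 < m) :
    ∃ δ : ℚ, ∀ q ∈ Ioo (0 : ℝ) 1, clausenPart m q =
      δ * (2 * Real.pi) ^ (m - 1) * (negapolygamma m q - (-1) ^ m * negapolygamma m (1 - q)) := by
  rcases eq_or_ne m 1 with rfl | hm1
  · refine ⟨1, fun q hq => ?_⟩
    rw [clausenPart_one_eq_logGamma hq, negapolygamma_one hq,
      negapolygamma_one ⟨sub_pos.mpr hq.2, by linarith [hq.1]⟩]
    simp
    ring
  have hm2 : 2 ≤ m := by lia
  have hpow : (2 * Real.pi) ^ (m - 1) * (2 * Real.pi * (2 * Real.pi) ^ (-(m : ℤ))) = 1 := by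
    rw [← mul_assoc, ← pow_succ, Nat.sub_add_cancel (by lia), zpow_neg, zpow_natCast,
      mul_inv_cancel₀ (by positivity)]
  have hfac : (m.factorial : ℝ) ≠ 0 := by positivity
  have h (δ : ℝ) (q : ℝ) : δ * (2 * Real.pi) ^ (m - 1) *
      (negapolygamma m q - (-1) ^ m * negapolygamma m (1 - q)) =
      -δ * ((-Complex.I) ^ m * polylog m (circlePoint q)).im := by
    rw [negapolygamma_sub, bernoulliA_sub hm2, mul_right_comm _ (m.factorial : ℝ), mul_div_assoc,
      div_self hfac]
    linear_combination (-δ * ((-Complex.I) ^ m * polylog m (circlePoint q)).im) * hpow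
  obtain ⟨k, rfl | rfl⟩ := Nat.even_or_odd' m
  · refine ⟨-(-1) ^ k, fun q hq => ?_⟩
    rw [h, clausenPart, if_pos (even_two_mul k), circlePolylog, if_neg hm1, pow_mul]
    have : ((-Complex.I) ^ 2) ^ k = (((-1) ^ k : ℝ) : ℂ) := by simp
    rw [this, Complex.im_ofReal_mul]
    push_cast
    rw [neg_neg, ← mul_assoc, ← mul_pow]
    simp
  · refine ⟨(-1) ^ k, fun q hq => ?_⟩
    rw [h, clausenPart, if_neg (by simp), circlePolylog, if_neg hm1, pow_succ, pow_mul]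
    have : ((-Complex.I) ^ 2) ^ k = (((-1) ^ k : ℝ) : ℂ) := by simp
    rw [this, mul_assoc, Complex.im_ofReal_mul]
    push_cast
    have hI : (-Complex.I * polylog (2 * k + 1) (circlePoint q)).im =
      -(polylog (2 * k + 1) (circlePoint q)).re := by simp
    rw [hI, neg_mul, mul_neg, mul_neg, neg_neg, ← mul_assoc, ← mul_pow]
    simp

/-! ### Integrability -/

theorem isTame_log : IsTame Real.log where
  aestronglyMeasurable := Real.measurable_log.aestronglyMeasurable
  exists_bound ε hε := by
    refine ⟨1 / ε, fun q hq => ?_⟩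
    have h := neg_log_le_rpow_neg_div hq.1 hε
    have hle : q ^ (-ε) ≤ (q * (1 - q)) ^ (-ε) :=
      Real.rpow_le_rpow_of_nonpos (mul_one_sub_pos hq) (by nlinarith [hq.1, hq.2]) (by linarith)
    rw [Real.norm_eq_abs, abs_of_nonpos (Real.log_nonpos hq.1.le hq.2.le), one_div_mul_eq_div]
    exact h.trans (by gcongr)

theorem isTame_logGamma : IsTame logGamma := by
  have hcont : ContinuousOn (fun q : ℝ => Real.log (Real.Gamma (q + 1))) (Icc 0 1) := by
    refine fun q hq => ContinuousAt.continuousWithinAt ?_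
    have hpos : 0 < q + 1 := by linarith [hq.1]
    have hG : ContinuousAt (fun q : ℝ => Real.Gamma (q + 1)) q :=
      ContinuousAt.comp (g := Real.Gamma) (f := fun q : ℝ => q + 1)
        (Real.differentiableAt_Gamma fun m => by
          linarith [(Nat.cast_nonneg m : (0 : ℝ) ≤ m)]).continuousAt (by fun_prop)
    exact hG.log (Real.Gamma_pos_of_pos hpos).ne'
  refine ((IsTame.of_continuousOn hcont).sub isTame_log).congr fun q hq => ?_
  rw [Real.Gamma_add_one hq.1.ne', Real.log_mul hq.1.ne' (Real.Gamma_pos_of_pos hq.1).ne', logGamma]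
  ring

theorem isTame_bernoulliFun (n : ℕ) : IsTame (bernoulliFun n) :=
  .of_continuous (continuous_bernoulliFun n)

theorem continuous_expZeta_natCast {m : ℕ} (hm : 2 ≤ m) :
    Continuous fun q : ℝ => HurwitzZeta.expZeta (q : UnitAddCircle) m := by
  simp_rw [expZeta_natCast hm]
  refine continuous_tsum (fun n => (continuous_circlePoint.pow n).div_const _)
    (Real.summable_one_div_nat_pow.mpr (show 1 < m by lia)) fun n q => ?_
  rw [norm_div, norm_pow, norm_pow, Complex.norm_natCast, norm_circlePoint, one_pow]

theorem continuous_deriv_expZeta_natCast {m : ℕ} (hm : 2 ≤ m) :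
    Continuous fun q : ℝ => deriv (HurwitzZeta.expZeta (q : UnitAddCircle)) m := by
  let f : ℝ → ℕ → ℂ := fun q n => Complex.exp (2 * Real.pi * Complex.I * q * n)
  have hf (q : ℝ) (n : ℕ) : ‖f q n‖ = 1 := by
    simp only [f]
    rw [show (2 * Real.pi * Complex.I * q * n : ℂ) = ((2 * Real.pi * q * n : ℝ) : ℂ) * Complex.I by
      push_cast; ring, Complex.norm_exp_ofReal_mul_I]
  have hm1 : 1 < (m : ℂ).re := by
    simp
    lia
  have habs (q : ℝ) : LSeries.abscissaOfAbsConv (f q) < ((m : ℂ).re : EReal) :=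
    (LSeries.abscissaOfAbsConv_le_of_le_const ⟨1, fun n _ => (hf q n).le⟩).trans_lt
      (by exact_mod_cast hm1)
  have hderiv (q : ℝ) : deriv (HurwitzZeta.expZeta (q : UnitAddCircle)) m =
      -LSeries (LSeries.logMul (f q)) m := by
    rw [← LSeries_deriv (habs q)]
    refine EventuallyEq.deriv_eq ?_
    filter_upwards [(isOpen_lt continuous_const Complex.continuous_re).mem_nhds hm1] with s hs
    exact (HurwitzZeta.LSeriesHasSum_exp q hs).LSeries_eq.symm
  simp_rw [hderiv]
  refine Continuous.neg (continuous_tsum (fun n => ?_)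
    (LSeriesSummable_logMul_of_lt_re (habs 0)).norm fun n q => ?_)
  · rcases eq_or_ne n 0 with rfl | hn
    · simp only [LSeries.term_zero]
      exact continuous_const
    · simp only [LSeries.term_of_ne_zero hn, LSeries.logMul, f]
      fun_prop
  · rcases eq_or_ne n 0 with rfl | hn
    · simp
    · rw [LSeries.term_of_ne_zero hn, LSeries.term_of_ne_zero hn, LSeries.logMul, LSeries.logMul,
        norm_div, norm_div, norm_mul, norm_mul, hf, hf]

theorem isTame_negapolygamma {m : ℕ} (hm : 0 < m) : IsTame (negapolygamma m) := by
  rcases eq_or_ne m 1 with rfl | hm1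
  · exact (isTame_logGamma.sub (.of_continuous continuous_const)).congr
      fun q hq => negapolygamma_one hq
  have hm2 : 2 ≤ m := by lia
  refine .of_continuous ?_
  obtain ⟨c, hc⟩ := exists_deriv_hurwitzZeta_one_sub hm2
  have hE := continuous_expZeta_natCast hm2
  have hE' : Continuous fun q : ℝ => HurwitzZeta.expZeta (-(q : UnitAddCircle)) m := by
    simpa only [Function.comp_def, AddCircle.coe_neg] using hE.comp continuous_neg
  have hD := continuous_deriv_expZeta_natCast hm2
  have hD' : Continuous fun q : ℝ => deriv (HurwitzZeta.expZeta (-(q : UnitAddCircle))) m := by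
    simpa only [Function.comp_def, AddCircle.coe_neg] using hD.comp continuous_neg
  unfold negapolygamma bernoulliA
  simp_rw [hc]
  have key : ∀ E E' D D' : ℝ → ℂ, Continuous E → Continuous E' → Continuous D → Continuous D' →
      Continuous fun q => ((m : ℝ) *
        (-(c * ((-Complex.I) ^ m * E q + Complex.I ^ m * E' q) +
          ((2 * Real.pi) ^ (-(m : ℤ)) * ((m - 1).factorial : ℂ)) *
            ((-Complex.I) ^ m * (-(Real.pi * Complex.I / 2) * E q + D q) +
              Complex.I ^ m * (Real.pi * Complex.I / 2 * E' q + D' q)))).re -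
        (harmonic (m - 1) : ℝ) * bernoulliFun m q) / (m.factorial : ℝ) := by
    intro E E' D D' _ _ _ _
    fun_prop
  exact key _ _ _ _ hE hE' hD hD'

theorem isTame_integrandK {m : ℕ} (n : ℕ) (hm : 0 < m) : IsTame (integrandK m n) :=
  ((isTame_negapolygamma hm).mul (isTame_bernoulliFun n)).mul isTame_logGamma

theorem isTame_integrandKStar {m : ℕ} (n : ℕ) (hm : 0 < m) : IsTame (integrandKStar m n) :=
  ((isTame_negapolygamma hm).comp_one_sub.mul (isTame_bernoulliFun n)).mul isTame_logGamma

theorem isTame_integrandZ {m n : ℕ} (hm : 0 < m) (hn : 0 < n) : IsTame (integrandZ m n) :=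
  ((isTame_negapolygamma hm).mul (isTame_negapolygamma hn)).mul isTame_logGamma

theorem isTame_integrandZStar {m n : ℕ} (hm : 0 < m) (hn : 0 < n) : IsTame (integrandZStar m n) :=
  ((isTame_negapolygamma hm).mul (isTame_negapolygamma hn).comp_one_sub).mul isTame_logGamma

theorem isTame_circlePolylog {a : ℕ} (ha : 0 < a) : IsTame (circlePolylog a) :=
  (isAbelFamily_polylog ha).isTame

theorem isTame_bernoulliPart {m : ℕ} (hm : 0 < m) : IsTame (bernoulliPart m) := by
  unfold bernoulliPart
  split_ifs
  · exact (isTame_circlePolylog hm).re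
  · exact (isTame_circlePolylog hm).im

theorem isTame_clausenPart {m : ℕ} (hm : 0 < m) : IsTame (clausenPart m) := by
  unfold clausenPart
  split_ifs
  · exact (isTame_circlePolylog hm).im
  · exact (isTame_circlePolylog hm).re

theorem IsTame.conj {f : ℝ → ℂ} (hf : IsTame f) : IsTame fun q => (starRingEnd ℂ) (f q) where
  aestronglyMeasurable := Complex.continuous_conj.comp_aestronglyMeasurable hf.aestronglyMeasurable
  exists_bound ε hε := by
    simpa only [Complex.norm_conj] using hf.exists_bound ε hε

theorem IsTame.integral_re {f : ℝ → ℂ} (hf : IsTame f) :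
    ∫ q in (0 : ℝ)..1, (f q).re = (∫ q in (0 : ℝ)..1, f q).re :=
  Complex.reCLM.intervalIntegral_comp_comm hf.intervalIntegrable

theorem IsTame.integral_im {f : ℝ → ℂ} (hf : IsTame f) :
    ∫ q in (0 : ℝ)..1, (f q).im = (∫ q in (0 : ℝ)..1, f q).im :=
  Complex.imCLM.intervalIntegral_comp_comm hf.intervalIntegrable

theorem IsTame.integral_add {f g : ℝ → ℝ} (hf : IsTame f) (hg : IsTame g) :
    ∫ q in (0 : ℝ)..1, (f q + g q) = (∫ q in (0 : ℝ)..1, f q) + ∫ q in (0 : ℝ)..1, g q :=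
  intervalIntegral.integral_add hf.intervalIntegrable hg.intervalIntegrable

/-! ### The Tornheim series as a real integral -/

theorem integral_clausenPart {x : ℕ} (hx : 0 < x) : ∫ q in (0 : ℝ)..1, clausenPart x q = 0 := by
  have h := isTame_circlePolylog hx
  unfold clausenPart
  split_ifs
  · rw [h.integral_im, integral_circlePolylog hx, Complex.zero_im]
  · rw [h.integral_re, integral_circlePolylog hx, Complex.zero_re]

/-- Parseval's identity for the real and imaginary parts of the polylogarithms. -/
theorem integral_clausenPart_mul_bernoulliPart {x k : ℕ} (hx : 0 < x) (hk : 0 < k) :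
    ∫ q in (0 : ℝ)..1, clausenPart x q * bernoulliPart k q =
      if Odd (x + k) then (∑' n : ℕ, 1 / (n : ℝ) ^ (x + k)) / 2 else 0 := by
  have h1 := (isTame_circlePolylog hx).mul (isTame_circlePolylog hk)
  have h2 := (isTame_circlePolylog hx).mul (isTame_circlePolylog hk).conj
  have r1 := h1.integral_re
  have r2 := h2.integral_re
  have i1 := h1.integral_im
  have i2 := h2.integral_im
  rw [integral_circlePolylog_mul hx hk] at r1 i1
  rw [integral_circlePolylog_mul_conj hx hk] at r2 i2
  rw [Complex.zero_re] at r1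
  rw [Complex.zero_im] at i1
  rw [Complex.ofReal_re] at r2
  rw [Complex.ofReal_im] at i2
  rcases Nat.even_or_odd x with px | px <;> rcases Nat.even_or_odd k with pk | pk
  · rw [if_neg (by simp [px.add pk])]
    have h : ∀ q, clausenPart x q * bernoulliPart k q =
        2⁻¹ * ((circlePolylog x q * circlePolylog k q).im +
          (circlePolylog x q * (starRingEnd ℂ) (circlePolylog k q)).im) := fun q => by
      simp [clausenPart, bernoulliPart, px, pk]
      ring
    simp_rw [h]
    rw [intervalIntegral.integral_const_mul, h1.im.integral_add h2.im, i1, i2]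
    simp
  · rw [if_pos (px.add_odd pk)]
    have h : ∀ q, clausenPart x q * bernoulliPart k q =
        2⁻¹ * ((circlePolylog x q * (starRingEnd ℂ) (circlePolylog k q)).re +
          -1 * (circlePolylog x q * circlePolylog k q).re) := fun q => by
      simp [clausenPart, bernoulliPart, px, Nat.not_even_iff_odd.mpr pk]
      ring
    simp_rw [h]
    rw [intervalIntegral.integral_const_mul, h2.re.integral_add (h1.re.const_mul (-1)),
      intervalIntegral.integral_const_mul, r1, r2]
    ring
  · rw [if_pos (px.add_even pk)]
    have h : ∀ q, clausenPart x q * bernoulliPart k q =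
        2⁻¹ * ((circlePolylog x q * (starRingEnd ℂ) (circlePolylog k q)).re +
          (circlePolylog x q * circlePolylog k q).re) := fun q => by
      simp [clausenPart, bernoulliPart, Nat.not_even_iff_odd.mpr px, pk]
      ring
    simp_rw [h]
    rw [intervalIntegral.integral_const_mul, h2.re.integral_add h1.re, r1, r2]
    ring
  · rw [if_neg (by simp [px.add_odd pk])]
    have h : ∀ q, clausenPart x q * bernoulliPart k q =
        2⁻¹ * ((circlePolylog x q * circlePolylog k q).im +
          -1 * (circlePolylog x q * (starRingEnd ℂ) (circlePolylog k q)).im) := fun q => by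
      simp [clausenPart, bernoulliPart, Nat.not_even_iff_odd.mpr px, Nat.not_even_iff_odd.mpr pk]
      ring
    simp_rw [h]
    rw [intervalIntegral.integral_const_mul, h1.im.integral_add (h2.im.const_mul (-1)),
      intervalIntegral.integral_const_mul, i1, i2]
    simp

/-- Since `∫ Li_a Li_b Li_c = 0`, any multiple of it may be added to the integral for the Tornheim
series. With `σ = 1` or `σ = -1` this replaces `conj Li_c` by twice its real or imaginary part, and
so puts the Bernoulli part of `Li_c` into the integrand. -/
theorem integral_re_circlePolylog_add {a b c : ℕ} (ha : 0 < a) (hb : 0 < b) (hc : 0 < c) (σ : ℝ) :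
    tornheim a b c = ∫ q in (0 : ℝ)..1,
      ((circlePolylog a q * (circlePolylog b q * (starRingEnd ℂ) (circlePolylog c q))).re +
        σ * (circlePolylog a q * (circlePolylog b q * circlePolylog c q)).re) := by
  have ta := isTame_circlePolylog ha
  have tb := isTame_circlePolylog hb
  have tc := isTame_circlePolylog hc
  have h1 := ta.mul (tb.mul tc.conj)
  have h2 := ta.mul (tb.mul tc)
  rw [h1.re.integral_add (h2.re.const_mul σ), intervalIntegral.integral_const_mul,
    h1.integral_re, h2.integral_re, integral_circlePolylog_mul_mul_conj ha hb hc,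
    integral_circlePolylog_mul_mul ha hb hc]
  simp

/-- For odd weight, the Tornheim series is a combination of integrals of products of one Clausen
function and two Bernoulli polynomials. -/
theorem tornheim_eq_of_odd {a b c : ℕ} (ha : 0 < a) (hb : 0 < b) (hc : 0 < c)
    (ha' : Odd a) (h : Odd (a + b + c)) :
    ∃ σ : ℚ, tornheim a b c =
      2 * (∫ q in (0 : ℝ)..1, clausenPart a q * (bernoulliPart b q * bernoulliPart c q)) +
        σ * ∫ q in (0 : ℝ)..1, clausenPart b q * (bernoulliPart a q * bernoulliPart c q) := by
  have t1 := (isTame_clausenPart ha).mul ((isTame_bernoulliPart hb).mul (isTame_bernoulliPart hc))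
  have t2 := (isTame_clausenPart hb).mul ((isTame_bernoulliPart ha).mul (isTame_bernoulliPart hc))
  have pa := Nat.not_even_iff_odd.mpr ha'
  rcases Nat.even_or_odd c with pc | pc
  · have pb : Even b := by grind
    refine ⟨-2, ?_⟩
    rw [integral_re_circlePolylog_add ha hb hc 1, ← intervalIntegral.integral_const_mul,
      ← intervalIntegral.integral_const_mul, ← (t1.const_mul 2).integral_add (t2.const_mul _)]
    refine intervalIntegral.integral_congr fun q _ => ?_
    simp [clausenPart, bernoulliPart, pa, pb, pc]
    ring
  · have pb : ¬ Even b := by grind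
    refine ⟨2, ?_⟩
    rw [integral_re_circlePolylog_add ha hb hc (-1), ← intervalIntegral.integral_const_mul,
      ← intervalIntegral.integral_const_mul, ← (t1.const_mul 2).integral_add (t2.const_mul _)]
    refine intervalIntegral.integral_congr fun q _ => ?_
    simp [clausenPart, bernoulliPart, pa, pb, Nat.not_even_iff_odd.mpr pc]
    ring

/-- For even weight, the Tornheim series is a combination of the integral of a product of two
Clausen functions and a Bernoulli polynomial, and that of a product of Bernoulli polynomials. -/
theorem tornheim_eq_of_even {a b c : ℕ} (ha : 0 < a) (hb : 0 < b) (hc : 0 < c)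
    (ha' : Odd a) (h : Even (a + b + c)) :
    ∃ σ : ℚ, tornheim a b c =
      2 * (∫ q in (0 : ℝ)..1, clausenPart a q * (clausenPart b q * bernoulliPart c q)) +
        σ * ∫ q in (0 : ℝ)..1, bernoulliPart a q * (bernoulliPart b q * bernoulliPart c q) := by
  have t1 := (isTame_clausenPart ha).mul ((isTame_clausenPart hb).mul (isTame_bernoulliPart hc))
  have t2 := (isTame_bernoulliPart ha).mul ((isTame_bernoulliPart hb).mul (isTame_bernoulliPart hc))
  have pa := Nat.not_even_iff_odd.mpr ha'
  rcases Nat.even_or_odd c with pc | pc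
  · have pb : ¬ Even b := by grind
    refine ⟨-2, ?_⟩
    rw [integral_re_circlePolylog_add ha hb hc 1, ← intervalIntegral.integral_const_mul,
      ← intervalIntegral.integral_const_mul, ← (t1.const_mul 2).integral_add (t2.const_mul _)]
    refine intervalIntegral.integral_congr fun q _ => ?_
    simp [clausenPart, bernoulliPart, pa, pb, pc]
    ring
  · have pb : Even b := by grind
    refine ⟨2, ?_⟩
    rw [integral_re_circlePolylog_add ha hb hc (-1), ← intervalIntegral.integral_const_mul,
      ← intervalIntegral.integral_const_mul, ← (t1.const_mul 2).integral_add (t2.const_mul _)]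
    refine intervalIntegral.integral_congr fun q _ => ?_
    simp [clausenPart, bernoulliPart, pa, pb, Nat.not_even_iff_odd.mpr pc]
    ring

/-! ### Integrals of one Clausen function and Bernoulli polynomials -/

/-- For `k ≥ 1` the integral is a rational multiple of `π^(-k) ζ(x + k)` if `x + k` is odd, and `0`
otherwise. As `x + N` is odd too, `(2π)^(N-k)` is then an even power of `π`. -/
theorem two_mul_pi_pow_mul_integral_clausenPart_mul_bernoulliFun_mem {w x N k : ℕ} (hw : 2 ≤ w)
    (hx : 0 < x) (hxN : Odd (x + N)) (hxw : x + N ≤ w) (hk : k ≤ N) :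
    (2 * Real.pi) ^ N * ∫ q in (0 : ℝ)..1, clausenPart x q * bernoulliFun k q ∈ zetaAlgebra w := by
  rcases Nat.eq_zero_or_pos k with rfl | hk0
  · simp [integral_clausenPart hx]
  obtain ⟨ε, hε, hB⟩ := exists_bernoulliPart_eq hk0
  have hint : ∫ q in (0 : ℝ)..1, clausenPart x q * bernoulliPart k q =
      (ε * (2 * Real.pi) ^ k) * ∫ q in (0 : ℝ)..1, clausenPart x q * bernoulliFun k q := by
    rw [← intervalIntegral.integral_const_mul]
    refine intervalIntegral.integral_congr_Ioo_of_le zero_le_one fun q hq => ?_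
    rw [hB q hq]
    ring
  have hεR : (ε : ℝ) ≠ 0 := by exact_mod_cast hε
  obtain ⟨j, rfl⟩ := Nat.exists_eq_add_of_le hk
  have hsolve : (2 * Real.pi) ^ (k + j) * ∫ q in (0 : ℝ)..1, clausenPart x q * bernoulliFun k q =
      ((ε⁻¹ : ℚ) : ℝ) * (2 * Real.pi) ^ j *
        ∫ q in (0 : ℝ)..1, clausenPart x q * bernoulliPart k q := by
    rw [hint, pow_add]
    push_cast
    field_simp
  rw [hsolve, integral_clausenPart_mul_bernoulliPart hx hk0]
  split_ifs with hodd
  · have hj : Even j := by grind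
    refine mul_mem (mul_mem (ratCast_mem_zetaAlgebra w _) (two_mul_pi_pow_mem_zetaAlgebra hw hj)) ?_
    rw [div_eq_mul_inv]
    refine mul_mem (tsum_one_div_nat_pow_mem_zetaAlgebra (by lia) (by lia)) ?_
    simpa using ratCast_mem_zetaAlgebra w 2⁻¹
  · simp

theorem pow_eq_sum_bernoulliFun (n : ℕ) (q : ℝ) :
    q ^ n = ∑ k ∈ Finset.range (n + 1),
      (((n + 1).choose k / (n + 1) : ℚ) : ℝ) * bernoulliFun k q := by
  have h := congrArg (fun P => (P.map (algebraMap ℚ ℝ)).eval q) (Polynomial.sum_bernoulli n)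
  simp only [Polynomial.map_sum, Polynomial.eval_finsetSum, Polynomial.map_smul,
    Polynomial.map_monomial, Polynomial.eval_monomial, Polynomial.eval_smul] at h
  have hn : (n : ℝ) + 1 ≠ 0 := by positivity
  have h' : ∑ k ∈ Finset.range (n + 1), ((n + 1).choose k : ℝ) * bernoulliFun k q =
      (n + 1) * q ^ n := by
    simpa [bernoulliFun] using h
  rw [← mul_right_inj' hn, ← h', Finset.mul_sum]
  refine Finset.sum_congr rfl fun k _ => ?_
  push_cast
  field_simp

theorem two_mul_pi_pow_mul_integral_clausenPart_mul_aeval_mem {w x N : ℕ} (hw : 2 ≤ w)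
    (hx : 0 < x) (hxN : Odd (x + N)) (hxw : x + N ≤ w) {P : Polynomial ℚ} (hP : P.natDegree ≤ N) :
    (2 * Real.pi) ^ N * ∫ q in (0 : ℝ)..1, clausenPart x q * Polynomial.aeval q P ∈
      zetaAlgebra w := by
  have hpoly (q : ℝ) : clausenPart x q * Polynomial.aeval q P =
      ∑ n ∈ Finset.range (N + 1), ∑ k ∈ Finset.range (n + 1),
        ((P.coeff n * ((n + 1).choose k / (n + 1)) : ℚ) : ℝ) *
          (clausenPart x q * bernoulliFun k q) := by
    rw [Polynomial.aeval_eq_sum_range' (Nat.lt_succ_of_le hP), Finset.mul_sum]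
    refine Finset.sum_congr rfl fun n _ => ?_
    rw [Rat.smul_def, pow_eq_sum_bernoulliFun, Finset.mul_sum, Finset.mul_sum]
    refine Finset.sum_congr rfl fun k _ => ?_
    push_cast
    ring
  have hint (c : ℝ) (k : ℕ) : IntervalIntegrable
      (fun q => c * (clausenPart x q * bernoulliFun k q)) volume 0 1 :=
    (((isTame_clausenPart hx).mul (isTame_bernoulliFun k)).const_mul c).intervalIntegrable
  simp_rw [hpoly, Finset.sum_sigma']
  rw [intervalIntegral.integral_finsetSum fun p _ => hint _ p.2, Finset.mul_sum]
  refine sum_mem fun p hp => ?_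
  rw [Finset.mem_sigma, Finset.mem_range, Finset.mem_range] at hp
  rw [intervalIntegral.integral_const_mul, mul_left_comm]
  exact mul_mem (ratCast_mem_zetaAlgebra w _)
    (two_mul_pi_pow_mul_integral_clausenPart_mul_bernoulliFun_mem hw hx hxN hxw (by lia))

theorem natDegree_bernoulli_le (n : ℕ) : (Polynomial.bernoulli n).natDegree ≤ n := by
  rw [Polynomial.bernoulli]
  refine Polynomial.natDegree_sum_le_of_forall_le _ _ fun i _ => ?_
  exact (Polynomial.natDegree_monomial_le _).trans (Nat.sub_le n i)

theorem bernoulliFun_eq_aeval (n : ℕ) (q : ℝ) :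
    bernoulliFun n q = Polynomial.aeval q (Polynomial.bernoulli n) := by
  rw [bernoulliFun, Polynomial.eval_map_algebraMap]

theorem integral_clausenPart_mul_bernoulliPart_mul_mem {w x y z : ℕ} (hw : 2 ≤ w) (hx : 0 < x)
    (hy : 0 < y) (hz : 0 < z) (hodd : Odd (x + y + z)) (hle : x + y + z ≤ w) :
    ∫ q in (0 : ℝ)..1, clausenPart x q * (bernoulliPart y q * bernoulliPart z q) ∈
      zetaAlgebra w := by
  obtain ⟨ε, -, hε⟩ := exists_bernoulliPart_eq hy
  obtain ⟨η, -, hη⟩ := exists_bernoulliPart_eq hz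
  have h : ∫ q in (0 : ℝ)..1, clausenPart x q * (bernoulliPart y q * bernoulliPart z q) =
      ((ε * η : ℚ) : ℝ) * ((2 * Real.pi) ^ (y + z) * ∫ q in (0 : ℝ)..1, clausenPart x q *
        Polynomial.aeval q (Polynomial.bernoulli y * Polynomial.bernoulli z)) := by
    rw [← mul_assoc, ← intervalIntegral.integral_const_mul]
    refine intervalIntegral.integral_congr_Ioo_of_le zero_le_one fun q hq => ?_
    rw [hε q hq, hη q hq, map_mul, ← bernoulliFun_eq_aeval, ← bernoulliFun_eq_aeval]
    push_cast
    ring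
  rw [h]
  refine mul_mem (ratCast_mem_zetaAlgebra w _)
    (two_mul_pi_pow_mul_integral_clausenPart_mul_aeval_mem hw hx (by rwa [← add_assoc])
      (by lia) ?_)
  exact Polynomial.natDegree_mul_le.trans
    (add_le_add (natDegree_bernoulli_le y) (natDegree_bernoulli_le z))

theorem exists_integral_aeval_eq (P : Polynomial ℚ) :
    ∃ r : ℚ, ∫ q in (0 : ℝ)..1, Polynomial.aeval q P = r := by
  refine ⟨∑ n ∈ Finset.range (P.natDegree + 1), P.coeff n * (1 / (n + 1)), ?_⟩
  simp_rw [Polynomial.aeval_eq_sum_range, Rat.smul_def]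
  rw [intervalIntegral.integral_finsetSum fun n _ =>
    Continuous.intervalIntegrable (by fun_prop) _ _]
  push_cast
  refine Finset.sum_congr rfl fun n _ => ?_
  rw [intervalIntegral.integral_const_mul, integral_pow]
  simp

theorem integral_bernoulliPart_mul_mul_mem {w x y z : ℕ} (hw : 2 ≤ w) (hx : 0 < x)
    (hy : 0 < y) (hz : 0 < z) (heven : Even (x + y + z)) :
    ∫ q in (0 : ℝ)..1, bernoulliPart x q * (bernoulliPart y q * bernoulliPart z q) ∈
      zetaAlgebra w := by
  obtain ⟨θ, -, hθ⟩ := exists_bernoulliPart_eq hx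
  obtain ⟨ε, -, hε⟩ := exists_bernoulliPart_eq hy
  obtain ⟨η, -, hη⟩ := exists_bernoulliPart_eq hz
  obtain ⟨r, hr⟩ := exists_integral_aeval_eq
    (Polynomial.bernoulli x * Polynomial.bernoulli y * Polynomial.bernoulli z)
  have h : ∫ q in (0 : ℝ)..1, bernoulliPart x q * (bernoulliPart y q * bernoulliPart z q) =
      ((θ * ε * η : ℚ) : ℝ) * (2 * Real.pi) ^ (x + y + z) * r := by
    rw [← hr, ← intervalIntegral.integral_const_mul]
    refine intervalIntegral.integral_congr_Ioo_of_le zero_le_one fun q hq => ?_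
    rw [hθ q hq, hε q hq, hη q hq, map_mul, map_mul, ← bernoulliFun_eq_aeval,
      ← bernoulliFun_eq_aeval, ← bernoulliFun_eq_aeval]
    push_cast
    ring
  rw [h]
  exact mul_mem (mul_mem (ratCast_mem_zetaAlgebra w _) (two_mul_pi_pow_mem_zetaAlgebra hw heven))
    (ratCast_mem_zetaAlgebra w r)

/-! ### Integrals of two Clausen functions and a Bernoulli polynomial -/

theorem clausenPart_mul_bernoulliPart_one_sub {b c : ℕ} (hb : 0 < b) (hc : 0 < c)
    (hodd : Odd (b + c)) {q : ℝ} (hq : q ∈ Ioo (0 : ℝ) 1) :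
    clausenPart b (1 - q) * bernoulliPart c (1 - q) = clausenPart b q * bernoulliPart c q := by
  have hq' : 1 - q ∈ Ioo (0 : ℝ) 1 := ⟨by linarith [hq.2], by linarith [hq.1]⟩
  obtain ⟨ε, -, hε⟩ := exists_bernoulliPart_eq hc
  obtain ⟨δ, hδ⟩ := exists_clausenPart_eq hb
  rw [hε _ hq, hε _ hq', hδ _ hq, hδ _ hq', bernoulliFun_eval_one_sub, sub_sub_cancel]
  rcases Nat.even_or_odd b with pb | pb
  · have pc : Odd c := by grind
    rw [pb.neg_one_pow, pc.neg_one_pow]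
    ring
  · have pc : Even c := by grind
    rw [pb.neg_one_pow, pc.neg_one_pow]
    ring

theorem isRep_integral_logGamma_mul {b c : ℕ} (hb : 0 < b) (hc : 0 < c) (hodd : Odd (b + c)) :
    IsRep (b + c + 1)
      (∫ q in (0 : ℝ)..1, logGamma q * (clausenPart b q * bernoulliPart c q)) := by
  obtain ⟨ε, -, hε⟩ := exists_bernoulliPart_eq hc
  obtain ⟨δ, hδ⟩ := exists_clausenPart_eq hb
  have h : ∫ q in (0 : ℝ)..1, logGamma q * (clausenPart b q * bernoulliPart c q) =
      ((δ * ε : ℚ) : ℝ) * (2 * Real.pi) ^ (b - 1 + c) * (integralK b c) +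
        ((-(-1) ^ b * δ * ε : ℚ) : ℝ) * (2 * Real.pi) ^ (b - 1 + c) * integralKStar b c := by
    rw [integralK, integralKStar, ← intervalIntegral.integral_const_mul,
      ← intervalIntegral.integral_const_mul,
      ← ((isTame_integrandK c hb).const_mul _).integral_add
        ((isTame_integrandKStar c hb).const_mul _)]
    refine intervalIntegral.integral_congr_Ioo_of_le zero_le_one fun q hq => ?_
    simp only [integrandK, integrandKStar]
    rw [hε q hq, hδ q hq, pow_add]
    push_cast
    ring
  have heven : Even (b - 1 + c) := by grind
  have hpi := two_mul_pi_pow_mem_zetaAlgebra (w := b + c + 1) (by lia) heven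
  rw [h]
  exact (IsRep.mul (mul_mem (ratCast_mem_zetaAlgebra _ _) hpi) (isRep_integralK hb hc)).add
    (IsRep.mul (mul_mem (ratCast_mem_zetaAlgebra _ _) hpi) (isRep_integralKStar hb hc))

theorem isRep_integral_clausenPart_one_mul {b c : ℕ} (hb : 0 < b) (hc : 0 < c)
    (hodd : Odd (b + c)) :
    IsRep (b + c + 1)
      (∫ q in (0 : ℝ)..1, clausenPart 1 q * (clausenPart b q * bernoulliPart c q)) := by
  have tf := (isTame_clausenPart hb).mul (isTame_bernoulliPart hc)
  have tG := isTame_logGamma.mul tf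
  have tG' := isTame_logGamma.comp_one_sub.mul tf
  have hrefl : ∫ q in (0 : ℝ)..1, logGamma (1 - q) * (clausenPart b q * bernoulliPart c q) =
      ∫ q in (0 : ℝ)..1, logGamma q * (clausenPart b q * bernoulliPart c q) := by
    have h := intervalIntegral.integral_comp_sub_left (a := 0) (b := 1)
      (fun q => logGamma q * (clausenPart b q * bernoulliPart c q)) 1
    rw [sub_self, sub_zero] at h
    rw [← h]
    refine intervalIntegral.integral_congr_Ioo_of_le zero_le_one fun q hq => ?_
    rw [clausenPart_mul_bernoulliPart_one_sub hb hc hodd hq]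
  have h : ∫ q in (0 : ℝ)..1, clausenPart 1 q * (clausenPart b q * bernoulliPart c q) =
      ((2 : ℚ) : ℝ) * (∫ q in (0 : ℝ)..1, logGamma q * (clausenPart b q * bernoulliPart c q)) +
        ((-1 / 2 : ℚ) : ℝ) * (Real.log (2 * Real.pi) * ∑' n : ℕ, 1 / (n : ℝ) ^ (b + c)) := by
    have hsplit : ∫ q in (0 : ℝ)..1, clausenPart 1 q * (clausenPart b q * bernoulliPart c q) =
        ∫ q in (0 : ℝ)..1, ((logGamma q * (clausenPart b q * bernoulliPart c q) +
          logGamma (1 - q) * (clausenPart b q * bernoulliPart c q)) +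
          -Real.log (2 * Real.pi) * (clausenPart b q * bernoulliPart c q)) := by
      refine intervalIntegral.integral_congr_Ioo_of_le zero_le_one fun q hq => ?_
      rw [clausenPart_one_eq_logGamma hq]
      ring
    rw [hsplit, (tG.add tG').integral_add (tf.const_mul _), tG.integral_add tG', hrefl,
      intervalIntegral.integral_const_mul, integral_clausenPart_mul_bernoulliPart hb hc,
      if_pos hodd]
    push_cast
    ring
  rw [h]
  refine (IsRep.mul (ratCast_mem_zetaAlgebra _ _) (isRep_integral_logGamma_mul hb hc hodd)).add
    (.of_mem (mul_mem (ratCast_mem_zetaAlgebra _ _) (mul_mem (log_two_mul_pi_mem_zetaAlgebra _)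
      (tsum_one_div_nat_pow_mem_zetaAlgebra ?_ (by lia)))))
  grind

/-! ### Evaluation of the Tornheim series -/

theorem isRep_tornheim_one {b c : ℕ} (hb : 0 < b) (hc : 0 < c) :
    IsRep (1 + b + c) (tornheim 1 b c) := by
  have h2 := ratCast_mem_zetaAlgebra (1 + b + c) 2
  rw [Rat.cast_ofNat] at h2
  rcases Nat.even_or_odd (1 + b + c) with h | h
  · obtain ⟨σ, hσ⟩ := tornheim_eq_of_even one_pos hb hc odd_one h
    rw [hσ]
    refine (IsRep.mul h2 ?_).add (.of_mem (mul_mem (ratCast_mem_zetaAlgebra _ σ)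
      (integral_bernoulliPart_mul_mul_mem (by lia) one_pos hb hc h)))
    rw [show 1 + b + c = b + c + 1 by ring]
    exact isRep_integral_clausenPart_one_mul hb hc (by grind)
  · obtain ⟨σ, hσ⟩ := tornheim_eq_of_odd one_pos hb hc odd_one h
    rw [hσ]
    exact .of_mem (add_mem
      (mul_mem h2 (integral_clausenPart_mul_bernoulliPart_mul_mem (by lia) one_pos hb hc h le_rfl))
      (mul_mem (ratCast_mem_zetaAlgebra _ σ)
        (integral_clausenPart_mul_bernoulliPart_mul_mem (by lia) hb one_pos hc
          (by rwa [add_comm b 1]) (by lia))))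

theorem theorem1p1 (n₁ n₂ n₃ : ℕ) (h₁ : 0 < n₁) (h₂ : 0 < n₂) (h₃ : 0 < n₃) :
    -- the double series converges
    (Summable fun p : ℕ+ × ℕ+ =>
      1 / ((p.1 : ℝ) ^ n₁ * (p.2 : ℝ) ^ n₂ * ((p.1 : ℝ) + (p.2 : ℝ)) ^ n₃)) ∧
    -- the four families of integrals converge
    (∀ m n : ℕ, 0 < m → 0 < n →
      IntervalIntegrable (integrandK m n) MeasureTheory.volume 0 1 ∧
      IntervalIntegrable (integrandKStar m n) MeasureTheory.volume 0 1 ∧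
      IntervalIntegrable (integrandZ m n) MeasureTheory.volume 0 1 ∧
      IntervalIntegrable (integrandZStar m n) MeasureTheory.volume 0 1) ∧
    -- the finite expression
    ∃ (e : zetaAlgebra (n₁ + n₂ + n₃)) (a b c d : ℕ × ℕ → zetaAlgebra (n₁ + n₂ + n₃)),
      tornheim n₁ n₂ n₃ =
        (e : ℝ) + ∑ p ∈ positivePairs (n₁ + n₂ + n₃ - 1),
          ((a p : ℝ) * integralK p.1 p.2 + (b p : ℝ) * integralKStar p.1 p.2 +
            (c p : ℝ) * integralZ p.1 p.2 + (d p : ℝ) * integralZStar p.1 p.2) := by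
  refine ⟨summable_tornheimTerm h₁ h₂ h₃, fun m n hm hn =>
    ⟨(isTame_integrandK n hm).intervalIntegrable, (isTame_integrandKStar n hm).intervalIntegrable,
      (isTame_integrandZ hm hn).intervalIntegrable,
      (isTame_integrandZStar hm hn).intervalIntegrable⟩, ?_⟩
  obtain ⟨e, a, b, h⟩ := isRep_tornheim_of_one
    (fun b c hb hc hw => hw ▸ isRep_tornheim_one hb hc) n₁ n₂ n₃ h₁ h₂ h₃ rfl
  exact ⟨e, a, b, 0, 0, by simpa using h⟩
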